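/- Let $G$ be a finite simple graph on $n$ vertices. Starting from a set $S\subseteq V(G)$ of blue vertices, all other vertices being white, apply the rule ``if a blue vertex has exactly one white neighbor, that neighbor becomes blue'' repeatedly; $S$ is a zero forcing set if eventually all vertices are blue. The zero forcing span $\lambda(G)$ is the number of integers $k$ for which there are sets $Z,F\subseteq V(G)$ with $|Z|=|F|=k$ such that $Z$ is a zero forcing set and $F$ is not. Let $P_k$ be the path on $k\ge 1$ vertices, $K_1$ the one-vertex graph, and $N(v)$ the set of neighbors of $v$ in $G$. A graph $G$ is a graph of two parallel paths if $G$ is not a path, and $V(G)$ can be partitioned into two nonempty sets $V_1,V_2$, each inducing a path, such that $G$ can be drawn in the plane with the two induced paths drawn as segments of two distinct parallel lines (a single point for $P_1$) and the edges between $V_1$ and $V_2$ drawn as straight line segments that do not cross. Such a drawing is called a standard drawing of $G$. Theorem. $\lambda(G)=n-3$ if and only if $G$ is one of the following graphs. \begin{enumerate} \item Two parallel paths with an additional $K_1$ component; that is, $G$ has an isolated vertex whose deletion leaves a graph of two parallel paths. \item $P_4$ or $P_5$. \item A graph of two parallel paths such that any standard drawing of it has one of the following forms (up to the choice of which of the two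 paths is named first, and the direction in which the paths are labelled). \begin{enumerate} \item The paths are $P_1=\{x\}$ and $P_k$ with $k\ge 3$, and \begin{enumerate} \item for some $u,v,w$ that form a subpath $uvw$ of $P_k$, $N(x)=\{u,w\}$ or $N(x)=\{u,v,w\}$; or \item for an end vertex $v$ of $P_k$ with neighbor $w$ on $P_k$, $N(x)=\{w\}$ or $N(x)=\{v,w\}$. \end{enumerate} \item The paths are $P_2=uv$ and $P_k$ with $N(u)\cap V(P_k)=N(v)\cap V(P_k)$, and if $k=1$ and $V(P_1)=\{x\}$, then $ux,vx\in E(G)$. \item The paths are $P_3=uvw$ and $P_k$, where $N(u)=N(w)=\{v\}$ or $N(u)=N(w)=\{v,x\}$ for some $x$ on $P_k$, and if $k=1$, then the vertex of $P_k$ is not isolated in $G$. \item The paths are $P_k=v_1v_2\cdots v_k$ and $P_j=w_1w_2\cdots w_j$ with $k,j\ge 2$, and the set of edges between $P_k$ and $P_j$ is one of $\{v_{k-1}w_1,\,v_kw_2\}$, $\{v_{k-1}w_1,\,v_kw_2,\,v_{k-1}w_2\}$, $\{v_{k-1}w_1,\,v_kw_2,\,v_kw_1\}$. \end{enumerate}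 \end{enumerate} -/

import Mathlib

namespace ZeroForcingSpan

variable {V : Type*}

/-- One application of the standard color change rule: `B` is the set of blue vertices, some blue
vertex `u` has exactly one white neighbor `v`, and `v` becomes blue. -/
def ColorChange [DecidableEq V] (G : SimpleGraph V) (B B' : Finset V) : Prop :=
  ∃ u ∈ B, ∃ v, v ∉ B ∧ (∀ w, (G.Adj u w ∧ w ∉ B) ↔ w = v) ∧ B' = insert v B

/-- `S` is a zero forcing set: starting from the blue set `S`, repeated applications of the color
change rule turn every vertex blue. -/
def IsZeroForcing [Fintype V] [DecidableEq V] (G : SimpleGraph V) (S : Finset V) : Prop :=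
  Relation.ReflTransGen (ColorChange G) S Finset.univ

/-- The zero forcing span `λ(G)`: the number of cardinalities `k` for which there are both a zero
forcing set with `k` elements and a set with `k` elements that is not zero forcing. (All such `k`
are at most the order of `G`, so this is the cardinality of a finite set.) -/
noncomputable def span [Fintype V] [DecidableEq V] (G : SimpleGraph V) : ℕ :=
  {k : ℕ | ∃ Z F : Finset V, Z.card = k ∧ F.card = k ∧
    IsZeroForcing G Z ∧ ¬ IsZeroForcing G F}.ncard

/-- `G` is the path `P_n` on `n` vertices. -/
def IsPathOn (G : SimpleGraph V) (n : ℕ) : Prop :=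
  Nonempty (G ≃g SimpleGraph.pathGraph n)

/-- A standard drawing of `G`: the vertices are partitioned into two nonempty sets, the ranges of
`p` and `q`, each of which induces a path, namely `p 0, p 1, …` and `q 0, q 1, …`. The vertices are
placed in the plane, each of the two paths being drawn along its own line, the two lines being
parallel and distinct (common direction `d`, through `a` and `b` respectively). The vertices
of each path occur on its line in the order of the path; both paths are labelled in the direction
of `d`. Edges between the two paths are straight line segments, no two of which cross. -/
structure StandardDrawing (G : SimpleGraph V) where
  k : ℕ
  j : ℕ
  k_pos : 0 < k
  j_pos : 0 < j
  p : SimpleGraph.pathGraph k ↪g G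
  q : SimpleGraph.pathGraph j ↪g G
  partition : IsCompl (Set.range p) (Set.range q)
  pos : V → ℝ × ℝ
  a : ℝ × ℝ
  b : ℝ × ℝ
  d : ℝ × ℝ
  distinct_lines : LinearIndependent ℝ ![d, b - a]
  s : Fin k → ℝ
  t : Fin j → ℝ
  s_mono : StrictMono s
  t_mono : StrictMono t
  pos_p : ∀ i, pos (p i) = a + s i • d
  pos_q : ∀ i, pos (q i) = b + t i • d
  not_crossing : ∀ (i i' : Fin k) (l l' : Fin j), G.Adj (p i) (q l) → G.Adj (p i') (q l') →
    (i, l) ≠ (i', l') →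
    Disjoint (openSegment ℝ (pos (p i)) (pos (q l))) (openSegment ℝ (pos (p i')) (pos (q l')))

/-- `G` is a graph of two parallel paths. -/
def TwoParallelPaths (G : SimpleGraph V) : Prop :=
  (¬ ∃ n, IsPathOn G n) ∧ Nonempty (StandardDrawing G)

/-- The first path is `P_1 = {x}` and the second is `P_k` with `k ≥ 3`, and either
`N(x) = {u, w}` or `N(x) = {u, v, w}` for a subpath `uvw` of `P_k`, or `N(x) = {w}` or
`N(x) = {v, w}` for an end vertex `v` of `P_k` and its neighbor `w` on `P_k`. -/
def FormA (G : SimpleGraph V) (V₁ V₂ : Set V) : Prop :=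
  ∃ x, V₁ = {x} ∧ 3 ≤ V₂.ncard ∧
    ((∃ u ∈ V₂, ∃ v ∈ V₂, ∃ w ∈ V₂, u ≠ w ∧ G.Adj u v ∧ G.Adj v w ∧
        (G.neighborSet x = {u, w} ∨ G.neighborSet x = {u, v, w})) ∨
      (∃ v ∈ V₂, ∃ w ∈ V₂, G.neighborSet v ∩ V₂ = {w} ∧
        (G.neighborSet x = {w} ∨ G.neighborSet x = {v, w})))

/-- The first path is `P_2 = uv`, and `u`, `v` have the same neighbors on the second path; if the
second path is a single vertex `x`, then `ux` and `vx` are edges. -/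
def FormB (G : SimpleGraph V) (V₁ V₂ : Set V) : Prop :=
  ∃ u v, V₁ = {u, v} ∧ G.Adj u v ∧ G.neighborSet u ∩ V₂ = G.neighborSet v ∩ V₂ ∧
    ∀ x, V₂ = {x} → G.Adj u x ∧ G.Adj v x

/-- The first path is `P_3 = uvw`, and `N(u) = N(w) = {v}` or `N(u) = N(w) = {v, x}` for some `x` on
the second path; if the second path is a single vertex, then this vertex is not isolated. -/
def FormC (G : SimpleGraph V) (V₁ V₂ : Set V) : Prop :=
  ∃ u v w, V₁ = {u, v, w} ∧ u ≠ w ∧ G.Adj u v ∧ G.Adj v w ∧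
    ((G.neighborSet u = {v} ∧ G.neighborSet w = {v}) ∨
      ∃ x ∈ V₂, G.neighborSet u = {v, x} ∧ G.neighborSet w = {v, x}) ∧
    ∀ x, V₂ = {x} → ∃ y, G.Adj x y

/-- The edges between `V₁` and `V₂`, as pairs with first entry in `V₁` and second in `V₂`. -/
def edgesBetween (G : SimpleGraph V) (V₁ V₂ : Set V) : Set (V × V) :=
  {e | e.1 ∈ V₁ ∧ e.2 ∈ V₂ ∧ G.Adj e.1 e.2}

/-- The paths are `v_1 ⋯ v_k` and `w_1 ⋯ w_j` with `k = m + 2` and `j = l + 2`, and the edges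
between them are `v_{k-1}w_1`, `v_kw_2` and at most one of `v_{k-1}w_2`, `v_kw_1`. -/
def FormD (G : SimpleGraph V) (V₁ V₂ : Set V) : Prop :=
  ∃ (m l : ℕ) (p : SimpleGraph.pathGraph (m + 2) ↪g G) (q : SimpleGraph.pathGraph (l + 2) ↪g G),
    Set.range p = V₁ ∧ Set.range q = V₂ ∧
    ∃ v' v w₁ w₂ : V, v' = p ⟨m, by omega⟩ ∧ v = p ⟨m + 1, by omega⟩ ∧
      w₁ = q ⟨0, by omega⟩ ∧ w₂ = q ⟨1, by omega⟩ ∧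
      (edgesBetween G V₁ V₂ = {(v', w₁), (v, w₂)} ∨
        edgesBetween G V₁ V₂ = {(v', w₁), (v, w₂), (v', w₂)} ∨
        edgesBetween G V₁ V₂ = {(v', w₁), (v, w₂), (v, w₁)})

/-- One of the four forms, for an ordered pair of paths with vertex sets `V₁` and `V₂`. -/
def IsListed (G : SimpleGraph V) (V₁ V₂ : Set V) : Prop :=
  FormA G V₁ V₂ ∨ FormB G V₁ V₂ ∨ FormC G V₁ V₂ ∨ FormD G V₁ V₂

/-- The drawing has one of the listed forms; either path may play the role of the first one. -/
def StandardDrawing.HasListedForm {G : SimpleGraph V} (D : StandardDrawing G) : Prop :=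
  IsListed G (Set.range D.p) (Set.range D.q) ∨ IsListed G (Set.range D.q) (Set.range D.p)

end ZeroForcingSpan

namespace ZeroForcingSpan

/-!
A *fort* is a nonempty set `W` such that no vertex outside `W` has exactly one neighbor in `W`. The
color change rule never enters a fort that is entirely white, and the complement of the final blue
set is a fort or empty, so a set is zero forcing iff it meets every fort. Let `Z` be the least size
of a zero forcing set and `F` the least size of a fort. Zero forcing sets exist in exactly the sizes
`Z, …, n` and sets that are not zero forcing in exactly the sizes `0, …, n - F`. Hence
`λ + F + Z = n + 1`, and `λ = n - 3` iff `(F, Z)` is `(1, 3)`, `(3, 1)` or `(2, 2)`.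

* `F = 1` iff there is an isolated vertex, and deleting it lowers `Z` by one.
* `Z = 1` iff the graph is a path, and `F = ⌊n / 2⌋ + 1` for the path on `n` vertices.
* `Z = 2` iff the graph is one of two parallel paths: the two forcing chains are induced paths, and
  two crossing edges between them would force each of two vertices to turn blue before the other.
* `F = 2` iff no vertex is isolated and there are twins (two vertices with the same neighbors apart
  from each other). The listed forms are the possible positions of twins in a standard drawing.
-/

open SimpleGraph

/-! ### Forts and zero forcing sets -/

section Forts

variable {V : Type*} {G : SimpleGraph V} {W : Finset V}

/-- A fort: a nonempty set of vertices such that no vertex outside it has exactly one neighbor in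
it. Forts are the sets that stay white under the color change rule. -/
def IsFort (G : SimpleGraph V) (W : Finset V) : Prop :=
  W.Nonempty ∧ ∀ u ∉ W, ∀ w ∈ W, G.Adj u w → ∃ w' ∈ W, w' ≠ w ∧ G.Adj u w'

variable (G) in
/-- The least size of a fort, with the value `0` if there are no forts. -/
noncomputable def fortNumber : ℕ :=
  sInf {k | ∃ W : Finset V, IsFort G W ∧ W.card = k}

lemma isFort_univ [Fintype V] [Nonempty V] : IsFort G Finset.univ :=
  ⟨Finset.univ_nonempty, fun u hu => absurd (Finset.mem_univ u) hu⟩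

lemma IsFort.fortNumber_le_card (hW : IsFort G W) : fortNumber G ≤ W.card :=
  Nat.sInf_le ⟨W, hW, rfl⟩

lemma exists_isFort_card_eq_fortNumber (h : fortNumber G ≠ 0) :
    ∃ W : Finset V, IsFort G W ∧ W.card = fortNumber G :=
  Nat.sInf_mem (Nat.nonempty_of_pos_sInf (Nat.pos_of_ne_zero h))

lemma IsFort.fortNumber_ne_zero (hW : IsFort G W) : fortNumber G ≠ 0 := by
  obtain ⟨W', hW', hcard⟩ : fortNumber G ∈ {k | ∃ W : Finset V, IsFort G W ∧ W.card = k} :=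
    Nat.sInf_mem ⟨_, W, hW, rfl⟩
  rw [← hcard]
  exact hW'.1.card_ne_zero

lemma isFort_singleton_iff {v : V} : IsFort G {v} ↔ G.IsIsolated v := by
  constructor
  · rintro ⟨-, h⟩ w hvw
    obtain ⟨w', hw', hne, -⟩ := h w (by simpa using hvw.ne') v (by simp) hvw.symm
    exact hne (Finset.mem_singleton.mp hw')
  · refine fun hv => ⟨Finset.singleton_nonempty v, fun u _ w hw huw => ?_⟩
    obtain rfl := Finset.mem_singleton.mp hw
    exact absurd huw.symm (hv u)

lemma fortNumber_eq_one_iff : fortNumber G = 1 ↔ ∃ v, G.IsIsolated v := by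
  constructor
  · intro h
    obtain ⟨W, hW, hcard⟩ := exists_isFort_card_eq_fortNumber (G := G) (by omega)
    obtain ⟨v, rfl⟩ := Finset.card_eq_one.mp (hcard.trans h)
    exact ⟨v, isFort_singleton_iff.mp hW⟩
  · rintro ⟨v, hv⟩
    have hfort := isFort_singleton_iff.mpr hv
    have hle := hfort.fortNumber_le_card
    have hpos := hfort.fortNumber_ne_zero
    rw [Finset.card_singleton] at hle
    omega

end Forts

section ZeroForcing

variable {V : Type*} [DecidableEq V] {G : SimpleGraph V} {S T W B B' : Finset V}

lemma ColorChange.ssubset (h : ColorChange G B B') : B ⊂ B' := by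
  obtain ⟨u, -, v, hv, -, rfl⟩ := h
  exact Finset.ssubset_insert hv

lemma ColorChange.disjoint_of_isFort (h : ColorChange G B B') (hW : IsFort G W)
    (hB : Disjoint W B) : Disjoint W B' := by
  obtain ⟨u, hu, v, -, huv, rfl⟩ := h
  refine Finset.disjoint_insert_right.mpr ⟨fun hvW => ?_, hB⟩
  have huW : u ∉ W := fun h => Finset.disjoint_left.mp hB h hu
  obtain ⟨w', hw', hne, hadj⟩ := hW.2 u huW v hvW ((huv v).mpr rfl).1
  exact hne ((huv w').mp ⟨hadj, Finset.disjoint_left.mp hB hw'⟩)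

variable [Fintype V]

lemma exists_colorChange_of_not_isFort_compl (hB : B ≠ Finset.univ) (h : ¬IsFort G Bᶜ) :
    ∃ B', ColorChange G B B' := by
  have hne : (Bᶜ).Nonempty := by
    rwa [Finset.nonempty_iff_ne_empty, ne_eq, Finset.compl_eq_empty_iff]
  simp only [IsFort, hne, true_and, Finset.mem_compl] at h
  push Not at h
  obtain ⟨u, hu, v, hv, huv, huniq⟩ := h
  refine ⟨_, u, hu, v, hv, fun w => ⟨fun hw => ?_, ?_⟩, rfl⟩
  · by_contra hne
    exact huniq w hw.2 hne hw.1
  · rintro rfl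
    exact ⟨huv, hv⟩

lemma IsZeroForcing.not_disjoint (hS : IsZeroForcing G S) (hW : IsFort G W) : ¬Disjoint W S := by
  intro hd
  have hwhite (B : Finset V) (hB : Relation.ReflTransGen (ColorChange G) S B) : Disjoint W B := by
    induction hB with
    | refl => exact hd
    | tail _ hstep ih => exact hstep.disjoint_of_isFort hW ih
  obtain ⟨w, hw⟩ := hW.1
  exact Finset.disjoint_left.mp (hwhite _ hS) hw (Finset.mem_univ w)

theorem isZeroForcing_iff_forall_isFort :
    IsZeroForcing G S ↔ ∀ W, IsFort G W → ¬Disjoint W S := by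
  refine ⟨fun hS W => hS.not_disjoint, fun h => ?_⟩
  induction S using WellFoundedGT.induction with
  | ind S ih =>
    by_cases hS : S = Finset.univ
    · exact hS ▸ Relation.ReflTransGen.refl
    obtain ⟨B, hB⟩ := exists_colorChange_of_not_isFort_compl hS (h _ · disjoint_compl_left)
    exact .head hB (ih B hB.ssubset fun W hW hd => h W hW (hd.mono_right hB.ssubset.subset))

lemma isZeroForcing_univ : IsZeroForcing G Finset.univ := Relation.ReflTransGen.refl

lemma IsZeroForcing.mono (hS : IsZeroForcing G S) (h : S ⊆ T) : IsZeroForcing G T :=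
  isZeroForcing_iff_forall_isFort.mpr fun _ hW hd => hS.not_disjoint hW (hd.mono_right h)

lemma IsZeroForcing.nonempty [Nonempty V] (hS : IsZeroForcing G S) : S.Nonempty := by
  by_contra hne
  rw [Finset.not_nonempty_iff_eq_empty] at hne
  exact hS.not_disjoint isFort_univ (hne ▸ Finset.disjoint_empty_right _)

variable (G) in
/-- The least size of a zero forcing set. -/
noncomputable def zeroForcingNumber : ℕ :=
  sInf {k | ∃ S : Finset V, IsZeroForcing G S ∧ S.card = k}

lemma IsZeroForcing.zeroForcingNumber_le_card (hS : IsZeroForcing G S) :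
    zeroForcingNumber G ≤ S.card :=
  Nat.sInf_le ⟨S, hS, rfl⟩

variable (G) in
lemma exists_isZeroForcing_card_eq_zeroForcingNumber :
    ∃ S : Finset V, IsZeroForcing G S ∧ S.card = zeroForcingNumber G :=
  Nat.sInf_mem (s := {k | ∃ S : Finset V, IsZeroForcing G S ∧ S.card = k})
    ⟨_, _, isZeroForcing_univ, rfl⟩

variable (G) in
lemma zeroForcingNumber_pos [Nonempty V] : 0 < zeroForcingNumber G := by
  obtain ⟨S, hS, hcard⟩ := exists_isZeroForcing_card_eq_zeroForcingNumber G
  rw [← hcard]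
  exact hS.nonempty.card_pos

lemma exists_isZeroForcing_card_eq_iff {k : ℕ} :
    (∃ S : Finset V, IsZeroForcing G S ∧ S.card = k) ↔
      zeroForcingNumber G ≤ k ∧ k ≤ Fintype.card V := by
  constructor
  · rintro ⟨S, hS, rfl⟩
    exact ⟨hS.zeroForcingNumber_le_card, S.card_le_univ⟩
  · rintro ⟨hle, hk⟩
    obtain ⟨S, hS, hcard⟩ := exists_isZeroForcing_card_eq_zeroForcingNumber G
    obtain ⟨T, hST, hT⟩ := Finset.exists_superset_card_eq (hcard ▸ hle) hk
    exact ⟨T, hS.mono hST, hT⟩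

lemma exists_not_isZeroForcing_card_eq_iff [Nonempty V] {k : ℕ} :
    (∃ S : Finset V, ¬IsZeroForcing G S ∧ S.card = k) ↔ k + fortNumber G ≤ Fintype.card V := by
  constructor
  · rintro ⟨S, hS, rfl⟩
    rw [isZeroForcing_iff_forall_isFort] at hS
    push Not at hS
    obtain ⟨W, hW, hd⟩ := hS
    calc S.card + fortNumber G ≤ S.card + W.card := by gcongr; exact hW.fortNumber_le_card
      _ = (S ∪ W).card := (Finset.card_union_of_disjoint hd.symm).symm
      _ ≤ Fintype.card V := Finset.card_le_univ _
  · intro h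
    obtain ⟨W, hW, hcard⟩ :=
      exists_isFort_card_eq_fortNumber (isFort_univ (G := G)).fortNumber_ne_zero
    obtain ⟨S, hSW, hS⟩ := Finset.exists_subset_card_eq (s := Wᶜ) (n := k)
      (by rw [Finset.card_compl]; omega)
    exact ⟨S, fun hS => hS.not_disjoint hW (disjoint_compl_right.mono_right hSW), hS⟩

theorem span_add_fortNumber_add_zeroForcingNumber [Nonempty V] :
    span G + fortNumber G + zeroForcingNumber G = Fintype.card V + 1 := by
  have hZ := zeroForcingNumber_pos G
  have hset : {k : ℕ | ∃ Z F : Finset V, Z.card = k ∧ F.card = k ∧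
      IsZeroForcing G Z ∧ ¬IsZeroForcing G F} =
      Finset.Icc (zeroForcingNumber G) (Fintype.card V - fortNumber G) := by
    ext k
    have hiff : (∃ Z F : Finset V, Z.card = k ∧ F.card = k ∧ IsZeroForcing G Z ∧
        ¬IsZeroForcing G F) ↔ (∃ S : Finset V, IsZeroForcing G S ∧ S.card = k) ∧
          ∃ S : Finset V, ¬IsZeroForcing G S ∧ S.card = k := by tauto
    rw [Set.mem_ofPred_eq, hiff, exists_isZeroForcing_card_eq_iff,
      exists_not_isZeroForcing_card_eq_iff, Finset.mem_coe, Finset.mem_Icc]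
    omega
  have hlow : zeroForcingNumber G - 1 + fortNumber G ≤ Fintype.card V := by
    obtain ⟨S, hS⟩ := Finset.exists_subset_card_eq (s := (Finset.univ : Finset V))
      (n := zeroForcingNumber G - 1)
      (isZeroForcing_univ.zeroForcingNumber_le_card.trans' (Nat.sub_le _ _))
    refine exists_not_isZeroForcing_card_eq_iff.mp ⟨S, fun h => ?_, hS.2⟩
    have := h.zeroForcingNumber_le_card
    omega
  rw [span, hset, Set.ncard_coe_finset, Nat.card_Icc]
  omega

theorem span_eq_card_sub_three_iff :
    (span G : ℤ) = Fintype.card V - 3 ↔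
      fortNumber G = 1 ∧ zeroForcingNumber G = 3 ∨ fortNumber G = 3 ∧ zeroForcingNumber G = 1 ∨
        fortNumber G = 2 ∧ zeroForcingNumber G = 2 := by
  rcases isEmpty_or_nonempty V with hV | hV
  · have hF : fortNumber G = 0 := by
      by_contra h
      obtain ⟨W, hW, -⟩ := exists_isFort_card_eq_fortNumber h
      exact hV.elim hW.1.choose
    simp only [Fintype.card_eq_zero, hF]
    omega
  · have hsum := span_add_fortNumber_add_zeroForcingNumber (G := G)
    have hF := (isFort_univ (G := G)).fortNumber_ne_zero
    have hZ := zeroForcingNumber_pos G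
    omega

end ZeroForcing

section Embeddings

variable {U V : Type*} {H : SimpleGraph U} {G : SimpleGraph V} {f : H ↪g G}

lemma IsFort.map (hf : ∀ a b, G.Adj (f a) b → b ∈ Set.range f) {W : Finset U}
    (hW : IsFort H W) : IsFort G (W.map f.toEmbedding) := by
  refine ⟨hW.1.map, ?_⟩
  simp only [Finset.mem_map, RelEmbedding.coe_toEmbedding]
  rintro u hu _ ⟨a, ha, rfl⟩ hadj
  obtain ⟨c, rfl⟩ := hf a u hadj.symm
  obtain ⟨a', ha', hne, hadj'⟩ :=
    hW.2 c (fun hc => hu ⟨c, hc, rfl⟩) a ha (f.map_adj_iff.mp hadj)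
  exact ⟨f a', ⟨a', ha', rfl⟩, f.injective.ne hne, f.map_adj_iff.mpr hadj'⟩

lemma IsFort.preimage (hf : ∀ a b, G.Adj (f a) b → b ∈ Set.range f) {W : Finset V}
    (hW : IsFort G W) (hne : ∃ a, f a ∈ W) : IsFort H (W.preimage f f.injective.injOn) := by
  simp only [IsFort, Finset.Nonempty, Finset.mem_preimage]
  refine ⟨hne, fun u hu w hw hadj => ?_⟩
  obtain ⟨w', hw', hne, hadj'⟩ := hW.2 (f u) hu (f w) hw (f.map_adj_iff.mpr hadj)
  obtain ⟨c, rfl⟩ := hf u w' hadj'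
  exact ⟨c, hw', ne_of_apply_ne f hne, f.map_adj_iff.mp hadj'⟩

lemma fortNumber_congr (e : H ≃g G) : fortNumber H = fortNumber G := by
  refine congrArg sInf (Set.ext fun k => ⟨?_, ?_⟩)
  · rintro ⟨W, hW, rfl⟩
    exact ⟨_, hW.map (f := e.toEmbedding) fun _ b _ => e.surjective b, W.card_map _⟩
  · rintro ⟨W, hW, rfl⟩
    exact ⟨_, hW.map (f := e.symm.toEmbedding) fun _ b _ => e.symm.surjective b, W.card_map _⟩

end Embeddings

section IsolatedVertex

variable {V : Type*} [Fintype V] [DecidableEq V] {G : SimpleGraph V} {v : V}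

lemma isZeroForcing_insert_map_subtype_iff (hv : G.IsIsolated v) {S : Finset ({v}ᶜ : Set V)} :
    IsZeroForcing G (insert v (S.map (.subtype _))) ↔ IsZeroForcing (G.induce {v}ᶜ) S := by
  let f : G.induce {v}ᶜ ↪g G := Embedding.induce _
  have hf (a : ({v}ᶜ : Set V)) (b : V) (h : G.Adj (f a) b) : b ∈ Set.range f :=
    ⟨⟨b, fun hb => hv a (hb ▸ h.symm)⟩, rfl⟩
  simp only [isZeroForcing_iff_forall_isFort, Finset.disjoint_insert_right]
  constructor
  · intro h W hW hd
    refine h _ (hW.map hf) ⟨fun hmem => ?_, (Finset.disjoint_map _).mpr hd⟩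
    obtain ⟨w, -, hw⟩ := Finset.mem_map.mp hmem
    exact w.2 hw
  · rintro h W hW ⟨hvW, hd⟩
    obtain ⟨x, hx⟩ := hW.1
    have hxv : x ≠ v := ne_of_mem_of_not_mem hx hvW
    refine h _ (hW.preimage hf ⟨⟨x, hxv⟩, hx⟩) (Finset.disjoint_left.mpr fun y hy hyS => ?_)
    exact Finset.disjoint_left.mp hd (Finset.mem_preimage.mp hy) (Finset.mem_map_of_mem _ hyS)

theorem zeroForcingNumber_eq_add_one_of_isIsolated (hv : G.IsIsolated v) :
    zeroForcingNumber G = zeroForcingNumber (G.induce {v}ᶜ) + 1 := by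
  have hcard (S : Finset ({v}ᶜ : Set V)) :
      (insert v (S.map (.subtype _))).card = S.card + 1 := by
    rw [Finset.card_insert_of_notMem (by simp), Finset.card_map]
  apply le_antisymm
  · obtain ⟨S, hS, hSc⟩ := exists_isZeroForcing_card_eq_zeroForcingNumber (G.induce {v}ᶜ)
    rw [← hSc, ← hcard]
    exact ((isZeroForcing_insert_map_subtype_iff hv).mpr hS).zeroForcingNumber_le_card
  · obtain ⟨Z, hZ, hZc⟩ := exists_isZeroForcing_card_eq_zeroForcingNumber G
    have hvZ : v ∈ Z := by simpa using hZ.not_disjoint (isFort_singleton_iff.mpr hv)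
    obtain ⟨S, rfl⟩ : ∃ S : Finset ({v}ᶜ : Set V), insert v (S.map (.subtype _)) = Z :=
      ⟨(Z.erase v).subtype _, by
        rw [Finset.subtype_map_of_mem (p := (· ∈ ({v}ᶜ : Set V))) fun x => Finset.ne_of_mem_erase,
          Finset.insert_erase hvZ]⟩
    rw [← hZc, hcard]
    exact Nat.succ_le_succ
      ((isZeroForcing_insert_map_subtype_iff hv).mp hZ).zeroForcingNumber_le_card

end IsolatedVertex

/-! ### Drawings of two parallel paths -/

section Paths

variable {V : Type*} {G : SimpleGraph V} {k : ℕ}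

lemma adj_path_iff (p : pathGraph k ↪g G) {i i' : Fin k} :
    G.Adj (p i) (p i') ↔ i.val + 1 = i'.val ∨ i'.val + 1 = i.val := by
  rw [p.map_adj_iff, pathGraph_adj]

/-- The vertex before the first fort vertex of an induced path needs a second neighbor in the fort,
and this neighbor lies off the path. -/
lemma IsFort.exists_adj_notMem_range [NeZero k] {W : Finset V} (hW : IsFort G W)
    (p : pathGraph k ↪g G) (hne : ∃ i, p i ∈ W) (h0 : p 0 ∉ W) :
    ∃ i, (∀ i', p i' ∈ W → i < i') ∧ ∃ x ∈ W, x ∉ Set.range p ∧ G.Adj (p i) x := by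
  obtain ⟨b, hb, hmin⟩ := exists_minimal_of_wellFoundedLT (fun i => p i ∈ W) hne
  have hfirst (i' : Fin k) (hi' : p i' ∈ W) : b ≤ i' := (le_total b i').elim id (hmin hi')
  have hb0 : b.val ≠ 0 := fun h => h0 ((Fin.ext h : b = 0) ▸ hb)
  let a : Fin k := ⟨b - 1, by omega⟩
  have hab : a.val + 1 = b.val := by simp only [a]; omega
  have hlt (i' : Fin k) (hi' : p i' ∈ W) : a < i' := by
    have := hfirst i' hi'
    omega
  obtain ⟨x, hx, hxb, hadj⟩ := hW.2 (p a) (fun ha => (hlt a ha).false) (p b) hb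
    ((adj_path_iff p).mpr (.inl hab))
  refine ⟨a, hlt, x, hx, ?_, hadj⟩
  rintro ⟨i', rfl⟩
  have hi' := hlt i' hx
  rcases (adj_path_iff p).mp hadj with h | h
  · exact hxb (congrArg p (Fin.ext (by omega)))
  · omega

lemma IsFort.mem_zero_of_surjective [NeZero k] {W : Finset V} (hW : IsFort G W)
    {p : pathGraph k ↪g G} (hp : Function.Surjective p) : p 0 ∈ W := by
  by_contra h0
  obtain ⟨w, hw⟩ := hW.1
  obtain ⟨i, rfl⟩ := hp w
  obtain ⟨-, -, x, -, hx, -⟩ := hW.exists_adj_notMem_range p ⟨i, hw⟩ h0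
  exact hx (hp x)

end Paths

section PathPairs

variable {V : Type*} {G : SimpleGraph V} {k j : ℕ}

/-- The combinatorial content of a standard drawing: two induced paths that partition the vertices,
with no crossing among the edges between them. -/
structure IsPathPair (p : pathGraph k ↪g G) (q : pathGraph j ↪g G) : Prop where
  isCompl : IsCompl (Set.range p) (Set.range q)
  noncrossing : ∀ ⦃i i' l l'⦄, i < i' → G.Adj (p i) (q l) → G.Adj (p i') (q l') → l ≤ l'

namespace IsPathPair

variable {p : pathGraph k ↪g G} {q : pathGraph j ↪g G}

lemma symm (h : IsPathPair p q) : IsPathPair q p where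
  isCompl := h.isCompl.symm
  noncrossing _ _ _ _ hlt hadj hadj' := by
    by_contra! hlt'
    exact (h.noncrossing hlt' hadj'.symm hadj.symm).not_gt hlt

lemma ne (h : IsPathPair p q) (i : Fin k) (l : Fin j) : p i ≠ q l :=
  h.isCompl.disjoint.ne_of_mem ⟨i, rfl⟩ ⟨l, rfl⟩

lemma mem_range_or_mem_range (h : IsPathPair p q) (x : V) : x ∈ Set.range p ∨ x ∈ Set.range q :=
  h.isCompl.sup_eq_top.ge (Set.mem_univ x)

lemma exists_adj_of_notMem_zero [NeZero k] (h : IsPathPair p q) {W : Finset V} (hW : IsFort G W)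
    (hne : ∃ i, p i ∈ W) (h0 : p 0 ∉ W) :
    ∃ i, (∀ i', p i' ∈ W → i < i') ∧ ∃ l, q l ∈ W ∧ G.Adj (p i) (q l) := by
  obtain ⟨i, hi, x, hxW, hxp, hadj⟩ := hW.exists_adj_notMem_range p hne h0
  obtain ⟨l, rfl⟩ := (h.mem_range_or_mem_range x).resolve_left hxp
  exact ⟨i, hi, l, hxW, hadj⟩

theorem isZeroForcing [NeZero k] [NeZero j] [Fintype V] [DecidableEq V] (h : IsPathPair p q) :
    IsZeroForcing G {p 0, q 0} := by
  refine isZeroForcing_iff_forall_isFort.mpr fun W hW hd => ?_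
  simp only [Finset.disjoint_insert_right, Finset.disjoint_singleton_right] at hd
  obtain ⟨hp0, hq0⟩ := hd
  obtain ⟨⟨i, hi⟩, ⟨l, hl⟩⟩ : (∃ i, p i ∈ W) ∧ ∃ l, q l ∈ W := by
    obtain ⟨w, hw⟩ := hW.1
    rcases h.mem_range_or_mem_range w with ⟨i, rfl⟩ | ⟨l, rfl⟩
    · obtain ⟨-, -, l, hl, -⟩ := h.exists_adj_of_notMem_zero hW ⟨i, hw⟩ hp0
      exact ⟨⟨i, hw⟩, l, hl⟩
    · obtain ⟨-, -, i, hi, -⟩ := h.symm.exists_adj_of_notMem_zero hW ⟨l, hw⟩ hq0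
      exact ⟨⟨i, hi⟩, l, hw⟩
  obtain ⟨i₁, hi₁, l₂, hl₂, hadj⟩ := h.exists_adj_of_notMem_zero hW ⟨i, hi⟩ hp0
  obtain ⟨l₁, hl₁, i₂, hi₂, hadj'⟩ := h.symm.exists_adj_of_notMem_zero hW ⟨l, hl⟩ hq0
  exact (h.noncrossing (hi₁ i₂ hi₂) hadj hadj'.symm).not_gt (hl₁ l₂ hl₂)

lemma zeroForcingNumber_le_two [NeZero k] [NeZero j] [Fintype V] [DecidableEq V]
    (h : IsPathPair p q) : zeroForcingNumber G ≤ 2 :=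
  h.isZeroForcing.zeroForcingNumber_le_card.trans Finset.card_le_two

end IsPathPair

end PathPairs

section Drawings

lemma not_disjoint_openSegment_iff {E : Type*} [AddCommGroup E] [Module ℝ E] {a b d : E}
    (hd : LinearIndependent ℝ ![d, b - a]) {s s' t t' : ℝ} :
    ¬Disjoint (openSegment ℝ (a + s • d) (b + t • d)) (openSegment ℝ (a + s' • d) (b + t' • d)) ↔
      ∃ x y : ℝ, 0 < x ∧ 0 < y ∧ x * (s' - s) + y * (t' - t) = 0 := by
  rw [Set.not_disjoint_iff]
  constructor
  · rintro ⟨-, ⟨x, y, hx, hy, hxy, rfl⟩, ⟨x', y', -, -, hxy', he⟩⟩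
    obtain rfl := eq_sub_of_add_eq hxy
    obtain rfl := eq_sub_of_add_eq hxy'
    have hzero : ((1 - y') * s' + y' * t' - ((1 - y) * s + y * t)) • d +
        (y' - y) • (b - a) = 0 := by
      rw [← sub_eq_zero.mpr he]
      module
    obtain ⟨hcoeff, hy'⟩ := LinearIndependent.pair_iff.mp hd _ _ hzero
    obtain rfl := sub_eq_zero.mp hy'
    exact ⟨1 - y', y', hx, hy, by linarith⟩
  · rintro ⟨x, y, hx, hy, he⟩
    have hxy : x + y ≠ 0 := (add_pos hx hy).ne'
    have hcoeff : x / (x + y) * s + y / (x + y) * t = x / (x + y) * s' + y / (x + y) * t' := by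
      field_simp
      linarith
    refine ⟨_, ⟨x / (x + y), y / (x + y), by positivity, by positivity, by field_simp, rfl⟩,
      ⟨x / (x + y), y / (x + y), by positivity, by positivity, by field_simp, ?_⟩⟩
    linear_combination (norm := module) -(congrArg (· • d) hcoeff)

variable {V : Type*} {G : SimpleGraph V} {k j : ℕ} {p : pathGraph k ↪g G} {q : pathGraph j ↪g G}

lemma StandardDrawing.isPathPair (D : StandardDrawing G) : IsPathPair D.p D.q where
  isCompl := D.partition
  noncrossing i i' l l' hlt hadj hadj' := by
    by_contra! hlt'
    refine absurd (D.not_crossing i i' l l' hadj hadj' fun he => hlt.ne (congrArg Prod.fst he)) ?_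
    rw [D.pos_p, D.pos_p, D.pos_q, D.pos_q, not_disjoint_openSegment_iff D.distinct_lines]
    exact ⟨D.t l - D.t l', D.s i' - D.s i, sub_pos.mpr (D.t_mono hlt'), sub_pos.mpr (D.s_mono hlt),
      by ring⟩

/-- The two paths are drawn at the integer points of two horizontal lines. -/
lemma IsPathPair.nonempty_standardDrawing [NeZero k] [NeZero j] (h : IsPathPair p q) :
    Nonempty (StandardDrawing G) := by
  have hd : LinearIndependent ℝ ![((1, 0) : ℝ × ℝ), (0, 1) - (0, 0)] := by
    rw [LinearIndependent.pair_iff]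
    intro s t hst
    simpa using hst
  let pos : V → ℝ × ℝ := Function.extend p (fun i => (0, 0) + (i.val : ℝ) • (1, 0))
    (Function.extend q (fun l => (0, 1) + (l.val : ℝ) • (1, 0)) 0)
  have hpos_p (i : Fin k) : pos (p i) = (0, 0) + (i.val : ℝ) • (1, 0) :=
    p.injective.extend_apply _ _ i
  have hpos_q (l : Fin j) : pos (q l) = (0, 1) + (l.val : ℝ) • (1, 0) := by
    simp only [pos]
    rw [Function.extend_apply' _ _ _ fun ⟨i, hi⟩ => h.ne i l hi, q.injective.extend_apply]
  refine ⟨⟨k, j, NeZero.pos k, NeZero.pos j, p, q, h.isCompl, pos, (0, 0), (0, 1), (1, 0), hd,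
    fun i => i.val, fun l => l.val, fun _ _ => Nat.cast_lt.mpr, fun _ _ => Nat.cast_lt.mpr,
    hpos_p, hpos_q, fun i i' l l' hadj hadj' hne => ?_⟩⟩
  rw [hpos_p, hpos_p, hpos_q, hpos_q]
  by_contra hcross
  obtain ⟨x, y, hx, hy, he⟩ := (not_disjoint_openSegment_iff hd).mp hcross
  have hpos {i i' : Fin k} {l l' : Fin j} (hlt : i < i') (hadj : G.Adj (p i) (q l))
      (hadj' : G.Adj (p i') (q l')) :
      0 < x * ((i'.val : ℝ) - i.val) + y * ((l'.val : ℝ) - l.val) := by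
    have hi : (i.val : ℝ) < i'.val := Nat.cast_lt.mpr hlt
    have hl : (l.val : ℝ) ≤ l'.val := Nat.cast_le.mpr (h.noncrossing hlt hadj hadj')
    exact add_pos_of_pos_of_nonneg (mul_pos hx (sub_pos.mpr hi))
      (mul_nonneg hy.le (sub_nonneg.mpr hl))
  rcases lt_trichotomy i i' with hlt | rfl | hlt
  · exact (hpos hlt hadj hadj').ne' he
  · have hl : (l'.val : ℝ) = l.val := by simpa [hy.ne', sub_eq_zero] using he
    exact hne (Prod.ext rfl (Fin.ext (Nat.cast_injective hl.symm)))
  · have := hpos hlt hadj' hadj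
    linarith

end Drawings

/-! ### Forcing chains -/

section ForcingRecords

variable {V : Type*} {G : SimpleGraph V} {S B : Finset V} {c c' : V → V} {t t' : V → ℕ}

/-- A record of how the blue set `S` grew to `B`. A vertex is forced by the last vertex of a forcing
chain and then becomes the last vertex of that chain; `c x` is the first vertex of the chain of `x`,
and `t x` is the time at which `x` turned blue. -/
structure IsForcingRecord (G : SimpleGraph V) (S B : Finset V) (c : V → V) (t : V → ℕ) :
    Prop where
  subset : S ⊆ B
  start_mem : ∀ x ∈ B, c x ∈ S
  start_eq : ∀ x ∈ S, c x = x
  injOn : Set.InjOn t B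
  le_of_adj : ∀ x ∈ B, ∀ y ∈ B, c x = c y → t x < t y → ∀ w, G.Adj x w → w ∈ B ∧ t w ≤ t y
  adj_of_next : ∀ x ∈ B, ∀ y ∈ B, c x = c y → t x < t y →
    (∀ z ∈ B, c z = c x → t z ≤ t x ∨ t y ≤ t z) → G.Adj x y

namespace IsForcingRecord

lemma congr (h : IsForcingRecord G S B c t) (hc : Set.EqOn c c' B) (ht : Set.EqOn t t' B) :
    IsForcingRecord G S B c' t' where
  subset := h.subset
  start_mem x hx := hc hx ▸ h.start_mem x hx
  start_eq x hx := hc (h.subset hx) ▸ h.start_eq x hx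
  injOn := h.injOn.congr ht
  le_of_adj x hx y hy := by
    rw [← hc hx, ← hc hy, ← ht hx, ← ht hy]
    intro hxy hlt w hw
    obtain ⟨hwB, hle⟩ := h.le_of_adj x hx y hy hxy hlt w hw
    exact ⟨hwB, ht hwB ▸ hle⟩
  adj_of_next x hx y hy := by
    rw [← hc hx, ← hc hy, ← ht hx, ← ht hy]
    intro hxy hlt hz
    exact h.adj_of_next x hx y hy hxy hlt fun z hzB hzx => by
      simpa only [ht hzB] using hz z hzB (hc hzB ▸ hzx)

lemma eq_of_adj_of_notMem (h : IsForcingRecord G S B c t) {u v x : V} (hu : u ∈ B) (hv : v ∉ B)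
    (huv : G.Adj u v) (hx : x ∈ B) (hxu : c x = c u) (hle : t u ≤ t x) : x = u := by
  by_contra hne
  have hlt : t u < t x := hle.lt_of_ne fun he => hne (h.injOn hx hu he.symm)
  exact hv (h.le_of_adj u hu x hx hxu.symm hlt v huv).1

variable [DecidableEq V]

lemma insert (h : IsForcingRecord G S B c t) {u v : V} (hu : u ∈ B) (hv : v ∉ B)
    (huv : ∀ w, G.Adj u w ∧ w ∉ B ↔ w = v) (hcv : c v = c u) (htv : ∀ x ∈ B, t x < t v) :
    IsForcingRecord G S (insert v B) c t where
  subset := h.subset.trans (Finset.subset_insert v B)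
  start_mem := (Finset.forall_mem_insert ..).mpr ⟨hcv ▸ h.start_mem u hu, h.start_mem⟩
  start_eq := h.start_eq
  injOn := by
    rw [Finset.coe_insert, Set.injOn_insert (Finset.mem_coe.not.mpr hv)]
    refine ⟨h.injOn, ?_⟩
    rintro ⟨x, hx, he⟩
    exact (htv x hx).ne he
  le_of_adj := by
    simp only [Finset.mem_insert]
    rintro x (rfl | hx) y (rfl | hy) hxy hlt w hw
    · exact absurd hlt (lt_irrefl _)
    · exact absurd hlt (htv y hy).not_gt
    · by_cases hwB : w ∈ B
      · exact ⟨.inr hwB, (htv w hwB).le⟩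
      suffices w = y from ⟨.inl this, this ▸ le_rfl⟩
      have hle : t u ≤ t x := by
        by_contra! hlt
        exact hwB (h.le_of_adj x hx u hu (hxy.trans hcv) hlt w hw).1
      obtain rfl := h.eq_of_adj_of_notMem hu hv ((huv y).mpr rfl).1 hx (hxy.trans hcv) hle
      exact (huv w).mp ⟨hw, hwB⟩
    · exact (h.le_of_adj x hx y hy hxy hlt w hw).imp_left .inr
  adj_of_next := by
    simp only [Finset.mem_insert]
    rintro x (rfl | hx) y (rfl | hy) hxy hlt hnext
    · exact absurd hlt (lt_irrefl _)
    · exact absurd hlt (htv y hy).not_gt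
    · have hadj := ((huv y).mpr rfl).1
      have hcx := hxy.trans hcv
      have hle := (hnext u (.inr hu) hcx.symm).resolve_right (htv u hu).not_ge
      exact h.eq_of_adj_of_notMem hu hv hadj hx hcx hle ▸ hadj
    · exact h.adj_of_next x hx y hy hxy hlt fun z hz => hnext z (.inr hz)

lemma exists_of_colorChange {B' : Finset V} (h : IsForcingRecord G S B c t)
    (hstep : ColorChange G B B') : ∃ c' t', IsForcingRecord G S B' c' t' := by
  obtain ⟨u, hu, v, hv, huv, rfl⟩ := hstep
  have hne {x : V} (hx : x ∈ B) : x ≠ v := ne_of_mem_of_not_mem hx hv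
  have hcongr := h.congr (c' := Function.update c v (c u))
    (t' := Function.update t v (B.sup t + 1))
    (fun x hx => (Function.update_of_ne (hne hx) _ _).symm)
    (fun x hx => (Function.update_of_ne (hne hx) _ _).symm)
  refine ⟨_, _, hcongr.insert hu hv huv ?_ fun x hx => ?_⟩
  · rw [Function.update_self, Function.update_of_ne (hne hu)]
  · rw [Function.update_self, Function.update_of_ne (hne hx)]
    exact Nat.lt_succ_of_le (Finset.le_sup hx)

end IsForcingRecord

theorem IsZeroForcing.exists_isForcingRecord [Fintype V] [DecidableEq V] (hS : IsZeroForcing G S) :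
    ∃ c t, IsForcingRecord G S Finset.univ c t := by
  suffices hrec : ∀ B, Relation.ReflTransGen (ColorChange G) S B →
      ∃ c t, IsForcingRecord G S B c t from hrec _ hS
  intro B hB
  induction hB with
  | refl =>
    obtain ⟨t, ht⟩ := exists_injective_nat V
    refine ⟨id, t, subset_rfl, fun x hx => hx, fun x _ => rfl, ht.injOn, ?_, ?_⟩
    all_goals
      rintro x - y - rfl hlt
      exact absurd hlt (lt_irrefl _)
  | tail _ hstep ih =>
    obtain ⟨c, t, h⟩ := ih
    exact h.exists_of_colorChange hstep

end ForcingRecords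

section Chains

variable {V : Type*} {G : SimpleGraph V}

lemma exists_path_of_adj_iff_next {s : Finset V} {t : V → ℕ} (ht : Set.InjOn t s)
    (hadj : ∀ x ∈ s, ∀ y ∈ s, t x < t y → (G.Adj x y ↔ ∀ z ∈ s, t z ≤ t x ∨ t y ≤ t z)) :
    ∃ p : pathGraph s.card ↪g G, Set.range p = s ∧ StrictMono (t ∘ p) := by
  classical
  let e := (s.image t).orderEmbOfFin (Finset.card_image_of_injOn ht)
  have he : Set.range e = t '' s := by
    rw [Finset.range_orderEmbOfFin, Finset.coe_image]
  have hmem (i : Fin s.card) : ∃ x ∈ s, t x = e i := he.subset ⟨i, rfl⟩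
  choose p hps hpt using hmem
  have hsurj (x : V) (hx : x ∈ s) : ∃ i, p i = x := by
    obtain ⟨i, hi⟩ := he.superset ⟨x, hx, rfl⟩
    exact ⟨i, ht (hps i) hx ((hpt i).trans hi)⟩
  have hmono : StrictMono (t ∘ p) := fun i i' hlt => by
    simpa only [Function.comp_apply, hpt] using e.strictMono hlt
  have hcov {i i' : Fin s.card} (hlt : i < i') : G.Adj (p i) (p i') ↔ i ⋖ i' := by
    rw [hadj _ (hps i) _ (hps i') (hmono hlt), CovBy, and_iff_right hlt]
    constructor
    · intro h m him hmi
      exact (h (p m) (hps m)).elim (hmono him).not_ge (hmono hmi).not_ge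
    · intro h z hz
      obtain ⟨m, rfl⟩ := hsurj z hz
      exact (le_or_gt m i).imp (hmono.le_iff_le.mpr ·) fun him =>
        hmono.le_iff_le.mpr (not_lt.mp (h him))
  refine ⟨⟨⟨p, hmono.injective.of_comp⟩, fun {i i'} => ?_⟩, Set.ext fun x => ⟨?_, hsurj x⟩, hmono⟩
  · rw [pathGraph, hasse_adj]
    change G.Adj (p i) (p i') ↔ _
    rcases lt_trichotomy i i' with hlt | rfl | hlt
    · rw [hcov hlt, or_iff_left fun h => h.lt.not_gt hlt]
    · simp
    · rw [G.adj_comm, hcov hlt, or_iff_right fun h => h.lt.not_gt hlt]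
  · rintro ⟨i, rfl⟩
    exact hps i

namespace IsForcingRecord

variable [Fintype V] {S : Finset V} {c : V → V} {t : V → ℕ}

lemma exists_path (h : IsForcingRecord G S Finset.univ c t) (a : V) :
    ∃ (n : ℕ) (p : pathGraph n ↪g G), Set.range p = {x | c x = a} ∧ StrictMono (t ∘ p) := by
  classical
  have hadj (x : V) (hx : c x = a) (y : V) (hy : c y = a) (hlt : t x < t y) :
      G.Adj x y ↔ ∀ z, c z = a → t z ≤ t x ∨ t y ≤ t z := by
    subst hx
    refine ⟨fun hadj z hz => ?_, fun hz => ?_⟩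
    · by_contra! hbetween
      exact (h.le_of_adj x (Finset.mem_univ x) z (Finset.mem_univ z) hz.symm hbetween.1 y
        hadj).2.not_gt hbetween.2
    · exact h.adj_of_next x (Finset.mem_univ x) y (Finset.mem_univ y) hy.symm hlt fun z _ => hz z
  obtain ⟨p, hp, hmono⟩ := exists_path_of_adj_iff_next (G := G) (s := {x | c x = a})
    (h.injOn.mono (Finset.coe_subset.mpr (Finset.subset_univ _)))
    (by simpa only [Finset.mem_filter_univ] using hadj)
  exact ⟨_, p, by simpa using hp, hmono⟩

lemma isPathPair [DecidableEq V] {a b : V} (hab : a ≠ b)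
    (h : IsForcingRecord G {a, b} Finset.univ c t)
    {k j : ℕ} {p : pathGraph k ↪g G} {q : pathGraph j ↪g G}
    (hp : Set.range p = {x | c x = a}) (hpt : StrictMono (t ∘ p))
    (hq : Set.range q = {x | c x = b}) (hqt : StrictMono (t ∘ q)) : IsPathPair p q := by
  have hcp (i : Fin k) : c (p i) = a := hp.subset ⟨i, rfl⟩
  have hcq (l : Fin j) : c (q l) = b := hq.subset ⟨l, rfl⟩
  refine ⟨⟨?_, ?_⟩, fun i i' l l' hlt hadj hadj' => ?_⟩
  · rw [hp, hq, Set.disjoint_left]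
    exact fun x hxa hxb => hab (hxa.symm.trans hxb)
  · rw [hp, hq, codisjoint_iff_le_sup]
    intro x _
    simpa using h.start_mem x (Finset.mem_univ x)
  · by_contra! hlt'
    have hle := (h.le_of_adj _ (Finset.mem_univ _) _ (Finset.mem_univ _)
      ((hcp i).trans (hcp i').symm) (hpt hlt) _ hadj).2
    have hle' := (h.le_of_adj _ (Finset.mem_univ _) _ (Finset.mem_univ _)
      ((hcq l').trans (hcq l).symm) (hqt hlt') _ hadj'.symm).2
    have heq : p i' = q l :=
      h.injOn (Finset.mem_univ _) (Finset.mem_univ _) (le_antisymm hle' hle)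
    exact hab ((hcp i').symm.trans (heq ▸ hcq l))

end IsForcingRecord

variable [Fintype V] [DecidableEq V]

theorem zeroForcingNumber_eq_one_iff [Nonempty V] :
    zeroForcingNumber G = 1 ↔ ∃ n, IsPathOn G n := by
  constructor
  · intro h
    obtain ⟨S, hS, hcard⟩ := exists_isZeroForcing_card_eq_zeroForcingNumber G
    obtain ⟨a, rfl⟩ := Finset.card_eq_one.mp (hcard.trans h)
    obtain ⟨c, t, hrec⟩ := hS.exists_isForcingRecord
    obtain ⟨n, p, hp, -⟩ := hrec.exists_path a
    have hsurj : Function.Surjective p := fun x =>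
      hp.superset (Finset.mem_singleton.mp (hrec.start_mem x (Finset.mem_univ x)))
    exact ⟨n, ⟨(RelIso.ofSurjective p hsurj).symm⟩⟩
  · rintro ⟨n, ⟨e⟩⟩
    have : NeZero n := ⟨by rintro rfl; exact (e (Classical.arbitrary V)).elim0⟩
    have hS : IsZeroForcing G {e.symm 0} :=
      isZeroForcing_iff_forall_isFort.mpr fun W hW hd => Finset.disjoint_singleton_right.mp hd
        (hW.mem_zero_of_surjective (p := e.symm.toEmbedding) e.symm.surjective)
    exact le_antisymm hS.zeroForcingNumber_le_card (zeroForcingNumber_pos G)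

lemma exists_isPathPair_of_zeroForcingNumber_eq_two (h : zeroForcingNumber G = 2) :
    ∃ (k j : ℕ) (_ : NeZero k) (_ : NeZero j) (p : pathGraph k ↪g G) (q : pathGraph j ↪g G),
      IsPathPair p q := by
  obtain ⟨S, hS, hcard⟩ := exists_isZeroForcing_card_eq_zeroForcingNumber G
  obtain ⟨a, b, hab, rfl⟩ := Finset.card_eq_two.mp (hcard.trans h)
  obtain ⟨c, t, hrec⟩ := hS.exists_isForcingRecord
  obtain ⟨k, p, hp, hpt⟩ := hrec.exists_path a
  obtain ⟨j, q, hq, hqt⟩ := hrec.exists_path b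
  obtain ⟨i, -⟩ := hp.superset (hrec.start_eq a (by simp))
  obtain ⟨l, -⟩ := hq.superset (hrec.start_eq b (by simp))
  exact ⟨k, j, ⟨i.pos.ne'⟩, ⟨l.pos.ne'⟩, p, q, hrec.isPathPair hab hp hpt hq hqt⟩

theorem twoParallelPaths_iff : TwoParallelPaths G ↔ zeroForcingNumber G = 2 := by
  constructor
  · rintro ⟨hpath, ⟨D⟩⟩
    have : NeZero D.k := ⟨D.k_pos.ne'⟩
    have : NeZero D.j := ⟨D.j_pos.ne'⟩
    have : Nonempty V := ⟨D.p 0⟩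
    have hle := D.isPathPair.zeroForcingNumber_le_two
    have hpos := zeroForcingNumber_pos G
    have hne := zeroForcingNumber_eq_one_iff.not.mpr hpath
    omega
  · intro h
    obtain ⟨k, j, _, _, p, q, hpq⟩ := exists_isPathPair_of_zeroForcingNumber_eq_two h
    have : Nonempty V := ⟨p 0⟩
    exact ⟨zeroForcingNumber_eq_one_iff.not.mp (by omega), hpq.nonempty_standardDrawing⟩

end Chains

/-! ### Forts of paths -/

section PathForts

variable {n : ℕ} [NeZero n]

lemma IsFort.exists_mem_val_eq_or_eq_add_one {W : Finset (Fin n)}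
    (hW : IsFort (pathGraph n) W) (i : Fin n) :
    ∃ x ∈ W, x.val = i.val ∨ x.val = i.val + 1 := by
  obtain ⟨i, hi⟩ := i
  induction i with
  | zero =>
    exact ⟨0, hW.mem_zero_of_surjective (p := Embedding.refl) Function.surjective_id, .inl rfl⟩
  | succ i ih =>
    obtain ⟨x, hx, hxi | hxi⟩ := ih (by omega)
    · by_cases hmem : ⟨i + 1, hi⟩ ∈ W
      · exact ⟨_, hmem, .inl rfl⟩
      obtain ⟨y, hy, hyx, hadj⟩ := hW.2 _ hmem x hx (pathGraph_adj.mpr (.inr (by rw [hxi])))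
      have hyx' := Fin.val_ne_of_ne hyx
      rw [pathGraph_adj] at hadj
      exact ⟨y, hy, .inr (by dsimp only at hxi hadj ⊢; omega)⟩
    · exact ⟨x, hx, .inl hxi⟩

lemma IsFort.half_add_one_le_card {W : Finset (Fin n)} (hW : IsFort (pathGraph n) W) :
    n / 2 + 1 ≤ W.card := by
  have hsurj : Set.SurjOn (fun x : Fin n => (x.val + 1) / 2) W (Finset.range (n / 2 + 1)) := by
    intro m hm
    rw [Finset.coe_range, Set.mem_Iio] at hm
    rcases m with _ | m
    · exact ⟨0, hW.mem_zero_of_surjective (p := Embedding.refl) Function.surjective_id, by simp⟩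
    · obtain ⟨x, hx, hxm⟩ := hW.exists_mem_val_eq_or_eq_add_one ⟨2 * m + 1, by omega⟩
      exact ⟨x, hx, by dsimp only at hxm ⊢; omega⟩
  simpa using Finset.card_le_card_of_surjOn _ hsurj

lemma exists_isFort_pathGraph_card_le :
    ∃ W : Finset (Fin n), IsFort (pathGraph n) W ∧ W.card ≤ n / 2 + 1 := by
  have hn := NeZero.pos n
  let f (m : ℕ) : Fin n := ⟨min (2 * m) (n - 1), by omega⟩
  have hmem (x : Fin n) : x ∈ (Finset.range (n / 2 + 1)).image f ↔ Even x.val ∨ x.val + 1 = n := by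
    simp only [Finset.mem_image, Finset.mem_range, f, Fin.ext_iff, Nat.even_iff]
    refine ⟨by rintro ⟨m, _, he⟩; omega, fun h => ⟨(x.val + 1) / 2, by omega, by omega⟩⟩
  refine ⟨_, ⟨⟨0, (hmem 0).mpr (.inl Even.zero)⟩, fun u hu w hw hadj => ?_⟩,
    Finset.card_image_le.trans_eq (Finset.card_range _)⟩
  rw [hmem, Nat.even_iff] at hu
  rw [pathGraph_adj] at hadj
  let w' : Fin n := ⟨2 * u.val - w.val, by omega⟩
  refine ⟨w', (hmem w').mpr (.inl (Nat.even_iff.mpr ?_)), Fin.ne_of_val_ne ?_,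
    pathGraph_adj.mpr ?_⟩
  all_goals
    dsimp only [w']
    omega

theorem fortNumber_pathGraph : fortNumber (pathGraph n) = n / 2 + 1 := by
  obtain ⟨W, hW, hcard⟩ := exists_isFort_pathGraph_card_le (n := n)
  obtain ⟨W', hW', hcard'⟩ := exists_isFort_card_eq_fortNumber hW.fortNumber_ne_zero
  exact le_antisymm (hW.fortNumber_le_card.trans hcard) (hcard' ▸ hW'.half_add_one_le_card)

end PathForts

section Spans

variable {V : Type*} [Fintype V] [DecidableEq V] {G : SimpleGraph V}

theorem fortNumber_eq_three_and_zeroForcingNumber_eq_one_iff :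
    fortNumber G = 3 ∧ zeroForcingNumber G = 1 ↔ IsPathOn G 4 ∨ IsPathOn G 5 := by
  have hforts {n : ℕ} [NeZero n] (h : IsPathOn G n) : fortNumber G = n / 2 + 1 :=
    (fortNumber_congr h.some).trans fortNumber_pathGraph
  constructor
  · rintro ⟨hF, hZ⟩
    obtain ⟨W, hW, -⟩ := exists_isFort_card_eq_fortNumber (G := G) (by omega)
    have : Nonempty V := ⟨hW.1.choose⟩
    obtain ⟨n, hn⟩ := zeroForcingNumber_eq_one_iff.mp hZ
    have : NeZero n := ⟨by rintro rfl; exact (hn.some hW.1.choose).elim0⟩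
    have hF' := hforts hn
    obtain rfl | rfl : n = 4 ∨ n = 5 := by omega
    exacts [.inl hn, .inr hn]
  · have hpath (n : ℕ) [NeZero n] (hn : n / 2 = 2) (h : IsPathOn G n) :
        fortNumber G = 3 ∧ zeroForcingNumber G = 1 := by
      have : Nonempty V := ⟨h.some.symm 0⟩
      exact ⟨by rw [hforts h, hn], zeroForcingNumber_eq_one_iff.mpr ⟨n, h⟩⟩
    rintro (h | h)
    exacts [hpath 4 rfl h, hpath 5 rfl h]

theorem fortNumber_eq_one_and_zeroForcingNumber_eq_three_iff :
    fortNumber G = 1 ∧ zeroForcingNumber G = 3 ↔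
      ∃ v, G.IsIsolated v ∧ TwoParallelPaths (G.induce {v}ᶜ) := by
  simp only [twoParallelPaths_iff]
  constructor
  · rintro ⟨hF, hZ⟩
    obtain ⟨v, hv⟩ := fortNumber_eq_one_iff.mp hF
    have := zeroForcingNumber_eq_add_one_of_isIsolated hv
    exact ⟨v, hv, by omega⟩
  · rintro ⟨v, hv, hZ⟩
    have := zeroForcingNumber_eq_add_one_of_isIsolated hv
    exact ⟨fortNumber_eq_one_iff.mpr ⟨v, hv⟩, by omega⟩

end Spans

/-! ### Twins in a standard drawing -/

/-- Two vertices are twins if they have the same neighbors apart from each other. -/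
def Twins {V : Type*} (G : SimpleGraph V) (u v : V) : Prop :=
  u ≠ v ∧ ∀ x, x ≠ u → x ≠ v → (G.Adj u x ↔ G.Adj v x)

section Twins

variable {U V : Type*} {H : SimpleGraph U} {G : SimpleGraph V} {u v : V}

lemma Twins.symm (h : Twins G u v) : Twins G v u :=
  ⟨h.1.symm, fun x hv hu => (h.2 x hu hv).symm⟩

lemma Twins.comap (f : H ↪g G) {a b : U} (h : Twins G (f a) (f b)) : Twins H a b :=
  ⟨ne_of_apply_ne f h.1, fun x ha hb => by
    simpa only [f.map_adj_iff] using h.2 (f x) (f.injective.ne ha) (f.injective.ne hb)⟩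

lemma Twins.neighborSet_sdiff (h : Twins G u v) :
    G.neighborSet u \ {v} = G.neighborSet v \ {u} := by
  ext x
  simp only [Set.mem_sdiff, mem_neighborSet, Set.mem_singleton_iff]
  constructor
  · rintro ⟨hux, hxv⟩
    exact ⟨(h.2 x hux.ne' hxv).mp hux, hux.ne'⟩
  · rintro ⟨hvx, hxu⟩
    exact ⟨(h.2 x hxu hvx.ne').mpr hvx, hvx.ne'⟩

lemma Twins.neighborSet_eq (h : Twins G u v) (huv : ¬G.Adj u v) :
    G.neighborSet u = G.neighborSet v := by
  have hv : v ∉ G.neighborSet u := huv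
  have hu : u ∉ G.neighborSet v := fun hvu => huv hvu.symm
  simpa only [Set.sdiff_singleton_eq_self hv, Set.sdiff_singleton_eq_self hu]
    using h.neighborSet_sdiff

lemma isFort_pair_iff [DecidableEq V] (huv : u ≠ v) : IsFort G {u, v} ↔ Twins G u v := by
  simp only [IsFort, Finset.insert_nonempty, true_and, Finset.mem_insert, Finset.mem_singleton,
    not_or, Twins, huv, ne_eq, not_false_eq_true]
  constructor
  · intro h x hxu hxv
    constructor
    · intro hadj
      obtain ⟨w, rfl | rfl, hne, hxw⟩ := h x ⟨hxu, hxv⟩ u (.inl rfl) hadj.symm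
      exacts [absurd rfl hne, hxw.symm]
    · intro hadj
      obtain ⟨w, rfl | rfl, hne, hxw⟩ := h x ⟨hxu, hxv⟩ v (.inr rfl) hadj.symm
      exacts [hxw.symm, absurd rfl hne]
  · rintro h x ⟨hxu, hxv⟩ w (rfl | rfl) hxw
    · exact ⟨v, .inr rfl, Ne.symm huv, ((h x hxu hxv).mp hxw.symm).symm⟩
    · exact ⟨u, .inl rfl, huv, ((h x hxu hxv).mpr hxw.symm).symm⟩

theorem fortNumber_eq_two_iff :
    fortNumber G = 2 ↔ (∃ u v, Twins G u v) ∧ ∀ v, ¬G.IsIsolated v := by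
  classical
  rw [← not_exists, ← fortNumber_eq_one_iff]
  constructor
  · intro h
    obtain ⟨W, hW, hcard⟩ := exists_isFort_card_eq_fortNumber (G := G) (by omega)
    obtain ⟨u, v, huv, rfl⟩ := Finset.card_eq_two.mp (hcard.trans h)
    exact ⟨⟨u, v, (isFort_pair_iff huv).mp hW⟩, by omega⟩
  · rintro ⟨⟨u, v, h⟩, hne⟩
    have hfort := (isFort_pair_iff h.1).mpr h
    have hle := hfort.fortNumber_le_card
    have hpos := hfort.fortNumber_ne_zero
    rw [Finset.card_pair h.1] at hle
    omega

end Twins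

section Paths

variable {V : Type*} {G : SimpleGraph V} {k j : ℕ}

lemma Twins.ends_of_pathGraph {a b : Fin k} (h : Twins (pathGraph k) a b) (hab : a < b) :
    a.val = 0 ∧ b.val + 1 = k ∧ k ≤ 3 := by
  have hadj (c : ℕ) (hc : c < k) (hca : c ≠ a) (hcb : c ≠ b) :
      (a.val + 1 = c ∨ c + 1 = a.val) ↔ (b.val + 1 = c ∨ c + 1 = b.val) := by
    simpa only [pathGraph_adj] using h.2 ⟨c, hc⟩ (Fin.ne_of_val_ne hca) (Fin.ne_of_val_ne hcb)
  have ha : a.val = 0 := by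
    by_contra ha
    have := hadj (a - 1) (by omega) (by omega) (by omega)
    omega
  have hb : b.val + 1 = k := by
    by_contra hb
    have := hadj (b + 1) (by omega) (by omega) (by omega)
    omega
  refine ⟨ha, hb, ?_⟩
  by_contra! hk
  have := hadj (a + 1) (by omega) (by omega) (by omega)
  omega

lemma neighborSet_inter_range (p : pathGraph k ↪g G) (i : Fin k) :
    G.neighborSet (p i) ∩ Set.range p = p '' (pathGraph k).neighborSet i := by
  rw [← SimpleGraph.Embedding.preimage_neighborSet (f := p), Set.image_preimage_eq_inter_range]

lemma neighborSet_pathGraph_eq_pair_or_singleton (hk : 2 ≤ k) (i : Fin k) :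
    (∃ a b, a ≠ b ∧ (pathGraph k).neighborSet i = {a, b}) ∨
      ∃ a, (pathGraph k).neighborSet i = {a} := by
  simp only [Set.ext_iff, mem_neighborSet, pathGraph_adj, Set.mem_insert_iff,
    Set.mem_singleton_iff, Fin.ext_iff, ne_eq]
  rcases Nat.eq_zero_or_pos i with h0 | hpos
  · exact .inr ⟨⟨1, hk⟩, fun x => by dsimp only; omega⟩
  rcases (Nat.succ_le_of_lt i.isLt).eq_or_lt with hlast | hlt
  · exact .inr ⟨⟨i - 1, by omega⟩, fun x => by dsimp only; omega⟩
  · exact .inl ⟨⟨i - 1, by omega⟩, ⟨i + 1, hlt⟩, by dsimp only; omega, fun x => by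
      dsimp only; omega⟩

end Paths

namespace IsPathPair

variable {V : Type*} {G : SimpleGraph V} {k j : ℕ}

lemma neighborSet_eq {p : pathGraph k ↪g G} {q : pathGraph j ↪g G} (h : IsPathPair p q)
    (i : Fin k) :
    G.neighborSet (p i) = p '' (pathGraph k).neighborSet i ∪ G.neighborSet (p i) ∩ Set.range q := by
  have huniv : Set.range p ∪ Set.range q = Set.univ := h.isCompl.sup_eq_top
  rw [← neighborSet_inter_range, ← Set.inter_union_distrib_left, huniv, Set.inter_univ]

lemma twins_iff {p : pathGraph k ↪g G} {q : pathGraph j ↪g G} (h : IsPathPair p q) {a b : Fin k}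
    (htwins : Twins G (p a) (p b)) (l : Fin j) : G.Adj (p a) (q l) ↔ G.Adj (p b) (q l) :=
  htwins.2 _ (h.ne a l).symm (h.ne b l).symm

lemma formB_of_twins {p : pathGraph 2 ↪g G} {q : pathGraph j ↪g G} (h : IsPathPair p q)
    (htwins : Twins G (p 0) (p 1)) (hiso : ∀ v, ¬G.IsIsolated v) :
    FormB G (Set.range p) (Set.range q) := by
  have hrange : Set.range p = {p 0, p 1} := by ext; simp [eq_comm]
  refine ⟨p 0, p 1, hrange, (adj_path_iff p).mpr (.inl rfl), ?_, fun x hx => ?_⟩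
  · ext x
    refine and_congr_left ?_
    rintro ⟨l, rfl⟩
    exact h.twins_iff htwins l
  · obtain ⟨l, rfl⟩ : x ∈ Set.range q := hx ▸ Set.mem_singleton x
    obtain ⟨y, hy⟩ := exists_adj_iff_not_isIsolated.mpr (hiso (q l))
    have hyp : y ∈ Set.range p := (h.mem_range_or_mem_range y).resolve_right fun hyq =>
      hy.ne' (hx.subset hyq)
    rw [hrange] at hyp
    obtain rfl | rfl := hyp
    · exact ⟨hy.symm, (h.twins_iff htwins l).mp hy.symm⟩
    · exact ⟨(h.twins_iff htwins l).mpr hy.symm, hy.symm⟩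

lemma formC_of_twins {p : pathGraph 3 ↪g G} {q : pathGraph j ↪g G} (h : IsPathPair p q)
    (htwins : Twins G (p 0) (p 2)) (hiso : ∀ v, ¬G.IsIsolated v) :
    FormC G (Set.range p) (Set.range q) := by
  have hrange : Set.range p = {p 0, p 1, p 2} := by
    ext
    simp [Fin.exists_fin_succ, eq_comm]
  have hN : G.neighborSet (p 0) = {p 1} ∪ G.neighborSet (p 0) ∩ Set.range q := by
    have hpath : (pathGraph 3).neighborSet 0 = {1} := by
      ext i
      fin_cases i <;> simp [pathGraph_adj]
    rw [← Set.image_singleton, ← hpath]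
    exact h.neighborSet_eq 0
  have hsub : (G.neighborSet (p 0) ∩ Set.range q).Subsingleton := by
    rintro _ ⟨hl, l, rfl⟩ _ ⟨hl', l', rfl⟩
    have h02 : (0 : Fin 3) < 2 := by decide
    exact congrArg q (le_antisymm (h.noncrossing h02 hl ((h.twins_iff htwins l').mp hl'))
      (h.noncrossing h02 hl' ((h.twins_iff htwins l).mp hl)))
  have heq : G.neighborSet (p 2) = G.neighborSet (p 0) :=
    (htwins.neighborSet_eq (by simp [pathGraph_adj])).symm
  refine ⟨p 0, p 1, p 2, hrange, htwins.1, (adj_path_iff p).mpr (.inl rfl),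
    (adj_path_iff p).mpr (.inl rfl), ?_, fun x _ => exists_adj_iff_not_isIsolated.mpr (hiso x)⟩
  simp only [heq, and_self]
  rcases hsub.eq_empty_or_singleton with hempty | ⟨x, hx⟩
  · exact .inl (by rw [hN, hempty, Set.union_empty])
  · exact .inr ⟨x, (hx.superset rfl).2, by rw [hN, hx, Set.singleton_union]⟩

theorem isListed_of_twins_on_path {p : pathGraph k ↪g G} {q : pathGraph j ↪g G}
    (h : IsPathPair p q) {a b : Fin k} (htwins : Twins G (p a) (p b))
    (hiso : ∀ v, ¬G.IsIsolated v) : IsListed G (Set.range p) (Set.range q) := by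
  wlog hab : a < b generalizing a b
  · exact this htwins.symm ((not_lt.mp hab).lt_of_ne (ne_of_apply_ne p htwins.1.symm))
  obtain ⟨ha, hb, hk⟩ := (htwins.comap p).ends_of_pathGraph hab
  obtain rfl | rfl : k = 2 ∨ k = 3 := by omega
  · obtain rfl : a = 0 := Fin.ext ha
    obtain rfl : b = 1 := Fin.ext (Nat.succ_injective hb)
    exact .inr (.inl (h.formB_of_twins htwins hiso))
  · obtain rfl : a = 0 := Fin.ext ha
    obtain rfl : b = 2 := Fin.ext (Nat.succ_injective hb)
    exact .inr (.inr (.inl (h.formC_of_twins htwins hiso)))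

end IsPathPair

section Forts

variable {V : Type*} {G : SimpleGraph V}

lemma IsFort.nontrivial {W : Finset V} (hW : IsFort G W) (hiso : ∀ v, ¬G.IsIsolated v) :
    W.Nontrivial := by
  obtain ⟨v, rfl⟩ | hnontrivial := hW.1.exists_eq_singleton_or_nontrivial
  · exact absurd (isFort_singleton_iff.mp hW) (hiso v)
  · exact hnontrivial

lemma exists_isFort_notMem [Fintype V] [DecidableEq V] (h : 1 < zeroForcingNumber G) (v : V) :
    ∃ W, IsFort G W ∧ v ∉ W := by
  by_contra! hforts
  have hv : IsZeroForcing G {v} := isZeroForcing_iff_forall_isFort.mpr fun W hW hd =>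
    Finset.disjoint_singleton_right.mp hd (hforts W hW)
  exact (hv.zeroForcingNumber_le_card.trans_eq (Finset.card_singleton v)).not_gt h

end Forts

lemma edgesBetween_range_eq_image {V : Type*} {G : SimpleGraph V} {k j : ℕ}
    (p : pathGraph k ↪g G) (q : pathGraph j ↪g G) {E : Set (Fin k × Fin j)}
    (hE : ∀ i l, G.Adj (p i) (q l) ↔ (i, l) ∈ E) :
    edgesBetween G (Set.range p) (Set.range q) = Prod.map p q '' E := by
  ext ⟨x, y⟩
  constructor
  · rintro ⟨⟨i, rfl⟩, ⟨l, rfl⟩, hadj⟩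
    exact ⟨(i, l), (hE i l).mp hadj, rfl⟩
  · rintro ⟨⟨i, l⟩, hmem, ⟨⟩⟩
    exact ⟨⟨i, rfl⟩, ⟨l, rfl⟩, (hE i l).mpr hmem⟩

namespace IsPathPair

variable {V : Type*} {G : SimpleGraph V} {k j : ℕ} {p : pathGraph k ↪g G} {q : pathGraph j ↪g G}
  {a : Fin k} {b : Fin j}

lemma adj_iff_of_twins (h : IsPathPair p q) (htwins : Twins G (p a) (q b)) {l : Fin j}
    (hl : l ≠ b) : G.Adj (p a) (q l) ↔ b.val + 1 = l.val ∨ l.val + 1 = b.val :=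
  (htwins.2 _ (h.ne a l).symm (q.injective.ne hl)).trans (adj_path_iff q)

lemma ends_of_twins (h : IsPathPair p q) (htwins : Twins G (p a) (q b)) :
    (a.val = 0 ∨ b.val = 0) ∧ (a.val + 1 = k ∨ b.val + 1 = j) := by
  have hadj (l : ℕ) (hl : l < j) (hadj : b.val + 1 = l ∨ l + 1 = b.val) :
      G.Adj (p a) (q ⟨l, hl⟩) :=
    (h.adj_iff_of_twins htwins (Fin.ne_of_val_ne (by dsimp only; omega))).mpr hadj
  have hadj' (i : ℕ) (hi : i < k) (hadj : a.val + 1 = i ∨ i + 1 = a.val) :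
      G.Adj (p ⟨i, hi⟩) (q b) :=
    ((h.symm.adj_iff_of_twins htwins.symm (Fin.ne_of_val_ne (by dsimp only; omega))).mpr hadj).symm
  constructor
  · by_contra! hne
    have := h.noncrossing (Fin.lt_def.mpr (by dsimp only; omega))
      (hadj' (a - 1) (by omega) (by omega)) (hadj (b - 1) (by omega) (by omega))
    simp only [Fin.le_def] at this
    omega
  · by_contra! hne
    have := h.noncrossing (Fin.lt_def.mpr (by dsimp only; omega))
      (hadj (b + 1) (by omega) (.inl rfl)) (hadj' (a + 1) (by omega) (.inl rfl))
    simp only [Fin.le_def] at this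
    omega

lemma formA_of_twins {p : pathGraph 1 ↪g G} (h : IsPathPair p q) (htwins : Twins G (p 0) (q b))
    (hj : 3 ≤ j) : FormA G (Set.range p) (Set.range q) := by
  have hrange : Set.range p = {p 0} := Set.range_unique
  have hN : G.neighborSet (p 0) \ {q b} = q '' (pathGraph j).neighborSet b := by
    rw [htwins.neighborSet_sdiff, Set.sdiff_eq, ← hrange, h.isCompl.compl_eq,
      neighborSet_inter_range]
  have hN' : G.neighborSet (p 0) = q '' (pathGraph j).neighborSet b ∨
      G.neighborSet (p 0) = insert (q b) (q '' (pathGraph j).neighborSet b) := by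
    rw [← hN, Set.insert_sdiff_singleton]
    by_cases hadj : q b ∈ G.neighborSet (p 0)
    · exact .inr (Set.insert_eq_of_mem hadj).symm
    · exact .inl (Set.sdiff_singleton_eq_self hadj).symm
  have hcard : 3 ≤ (Set.range q).ncard := by
    rwa [← Set.image_univ, Set.ncard_image_of_injective _ q.injective, Set.ncard_univ,
      Nat.card_fin]
  refine ⟨p 0, hrange, hcard, ?_⟩
  rcases neighborSet_pathGraph_eq_pair_or_singleton (by omega) b with ⟨c, d, hcd, hb⟩ | ⟨c, hb⟩
  · have hc : (pathGraph j).Adj b c := hb.superset (.inl rfl)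
    have hd : (pathGraph j).Adj b d := hb.superset (.inr rfl)
    rw [hb, Set.image_pair, Set.insert_comm] at hN'
    exact .inl ⟨q c, ⟨c, rfl⟩, q b, ⟨b, rfl⟩, q d, ⟨d, rfl⟩, q.injective.ne hcd,
      q.map_adj_iff.mpr hc.symm, q.map_adj_iff.mpr hd, hN'⟩
  · rw [hb, Set.image_singleton] at hN'
    refine .inr ⟨q b, ⟨b, rfl⟩, q c, ⟨c, rfl⟩, ?_, hN'⟩
    rw [neighborSet_inter_range, hb, Set.image_singleton]

/-- The fort must be `{q 0, q 1}`, and `p 0`, not being isolated, is adjacent to both vertices. -/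
lemma formB_of_isFort {p : pathGraph 1 ↪g G} (h : IsPathPair p q) (hj : j ≤ 2)
    (hiso : ∀ v, ¬G.IsIsolated v) {W : Finset V} (hW : IsFort G W) (hpW : p 0 ∉ W) :
    FormB G (Set.range q) (Set.range p) := by
  have hcases (x : V) (hx : x ≠ p 0) : ∃ l, q l = x :=
    (h.mem_range_or_mem_range x).resolve_left fun ⟨i, hi⟩ =>
      hx (by rw [← hi, Subsingleton.elim i 0])
  obtain ⟨x, hx, y, hy, hxy⟩ := hW.nontrivial hiso
  obtain ⟨a, rfl⟩ := hcases x (ne_of_mem_of_not_mem hx hpW)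
  obtain ⟨b, rfl⟩ := hcases y (ne_of_mem_of_not_mem hy hpW)
  have hab : a ≠ b := ne_of_apply_ne q hxy
  obtain rfl : j = 2 := by omega
  have hqW (l : Fin 2) : q l ∈ W := by
    obtain rfl | rfl : l = a ∨ l = b := by omega
    exacts [hx, hy]
  obtain ⟨z, hz⟩ := exists_adj_iff_not_isIsolated.mpr (hiso (p 0))
  obtain ⟨c, rfl⟩ := hcases z hz.ne'
  obtain ⟨z', hz'W, hne, hz'⟩ := hW.2 (p 0) hpW (q c) (hqW c) hz
  obtain ⟨d, rfl⟩ := hcases z' hz'.ne'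
  have hcd : d ≠ c := ne_of_apply_ne q hne
  have hadj (l : Fin 2) : G.Adj (q l) (p 0) := by
    obtain rfl | rfl : l = c ∨ l = d := by omega
    exacts [hz.symm, hz'.symm]
  refine h.symm.formB_of_twins ⟨q.injective.ne (by decide), fun x hx₀ hx₁ => ?_⟩ hiso
  obtain rfl | hx := eq_or_ne x (p 0)
  · exact iff_of_true (hadj 0) (hadj 1)
  · obtain ⟨l, rfl⟩ := hcases x hx
    obtain rfl | rfl : l = 0 ∨ l = 1 := by omega
    exacts [absurd rfl hx₀, absurd rfl hx₁]

section LastZero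

variable {m l : ℕ} {p : pathGraph (m + 2) ↪g G} {q : pathGraph (l + 2) ↪g G}

lemma adj_last_one_of_twins (h : IsPathPair p q) (htwins : Twins G (p (Fin.last (m + 1))) (q 0)) :
    G.Adj (p (Fin.last (m + 1))) (q 1) :=
  (h.adj_iff_of_twins htwins one_ne_zero).mpr (.inl (by simp))

lemma adj_castSucc_last_zero_of_twins (h : IsPathPair p q)
    (htwins : Twins G (p (Fin.last (m + 1))) (q 0)) : G.Adj (p (Fin.last m).castSucc) (q 0) :=
  ((h.symm.adj_iff_of_twins htwins.symm (Fin.castSucc_lt_last _).ne).mpr (.inr (by simp))).symm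

lemma eq_or_eq_of_twins_of_adj (h : IsPathPair p q)
    (htwins : Twins G (p (Fin.last (m + 1))) (q 0)) {i : Fin (m + 2)} {x : Fin (l + 2)}
    (hix : G.Adj (p i) (q x)) :
    (i = (Fin.last m).castSucc ∨ i = Fin.last (m + 1)) ∧ (x = 0 ∨ x = 1) := by
  obtain rfl | hi := eq_or_ne i (Fin.last (m + 1))
  · refine ⟨.inr rfl, or_iff_not_imp_left.mpr fun hx => Fin.ext ?_⟩
    have := (h.adj_iff_of_twins htwins hx).mp hix
    simp only [Fin.val_zero, Fin.val_one] at this ⊢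
    omega
  obtain rfl | hx := eq_or_ne x 0
  · refine ⟨.inl (Fin.ext ?_), .inl rfl⟩
    have := (h.symm.adj_iff_of_twins htwins.symm hi).mp hix.symm
    simp only [Fin.val_last, Fin.val_castSucc] at this ⊢
    omega
  have hx1 := h.noncrossing (Fin.lt_last_iff_ne_last.mpr hi) hix (h.adj_last_one_of_twins htwins)
  have him := mt (fun hlt => h.noncrossing hlt hix (h.adj_castSucc_last_zero_of_twins htwins))
    (not_le.mpr (Fin.pos_of_ne_zero hx))
  simp only [Fin.ext_iff, Fin.le_def, Fin.lt_def, Fin.val_last, Fin.val_castSucc, Fin.val_zero,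
    Fin.val_one] at *
  omega

lemma formD_of_twins (h : IsPathPair p q) (htwins : Twins G (p (Fin.last (m + 1))) (q 0)) :
    FormD G (Set.range p) (Set.range q) := by
  set v' := (Fin.last m).castSucc
  set v := Fin.last (m + 1)
  have hnot : G.Adj (p v') (q 1) → ¬G.Adj (p v) (q 0) := fun h₁ h₂ =>
    (h.noncrossing (Fin.castSucc_lt_last _) h₁ h₂).not_gt Fin.zero_lt_one
  have hadj_iff (i : Fin (m + 2)) (x : Fin (l + 2)) : G.Adj (p i) (q x) ↔ i = v' ∧ x = 0 ∨
      i = v ∧ x = 1 ∨ i = v' ∧ x = 1 ∧ G.Adj (p v') (q 1) ∨ i = v ∧ x = 0 ∧ G.Adj (p v) (q 0) := by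
    constructor
    · intro hix
      obtain ⟨rfl | rfl, rfl | rfl⟩ := h.eq_or_eq_of_twins_of_adj htwins hix
      exacts [.inl ⟨rfl, rfl⟩, .inr (.inr (.inl ⟨rfl, rfl, hix⟩)),
        .inr (.inr (.inr ⟨rfl, rfl, hix⟩)), .inr (.inl ⟨rfl, rfl⟩)]
    · rintro (⟨rfl, rfl⟩ | ⟨rfl, rfl⟩ | ⟨rfl, rfl, hix⟩ | ⟨rfl, rfl, hix⟩)
      exacts [h.adj_castSucc_last_zero_of_twins htwins, h.adj_last_one_of_twins htwins, hix, hix]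
  have himage {i i' : Fin (m + 2)} {x x' : Fin (l + 2)} :
      Prod.map p q '' {(i, x), (i', x')} = {(p i, q x), (p i', q x')} := Set.image_pair ..
  refine ⟨m, l, p, q, rfl, rfl, p v', p v, q 0, q 1, rfl, rfl, rfl, rfl, ?_⟩
  by_cases h₁ : G.Adj (p v') (q 1)
  · have hE := edgesBetween_range_eq_image p q (E := {(v', 0), (v, 1), (v', 1)}) fun i x => by
      simp [hadj_iff i x, h₁, hnot h₁]
    exact .inr (.inl (by rw [hE, Set.image_insert_eq, himage]; rfl))
  by_cases h₂ : G.Adj (p v) (q 0)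
  · have hE := edgesBetween_range_eq_image p q (E := {(v', 0), (v, 1), (v, 0)}) fun i x => by
      simp [hadj_iff i x, h₁, h₂]
    exact .inr (.inr (by rw [hE, Set.image_insert_eq, himage]; rfl))
  · have hE := edgesBetween_range_eq_image p q (E := {(v', 0), (v, 1)}) fun i x => by
      simp [hadj_iff i x, h₁, h₂]
    exact .inl (hE.trans himage)

end LastZero

theorem isListed_of_twins_across (h : IsPathPair p q) (htwins : Twins G (p a) (q b))
    (hiso : ∀ v, ¬G.IsIsolated v) (hforts : ∀ v, ∃ W, IsFort G W ∧ v ∉ W) :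
    IsListed G (Set.range p) (Set.range q) ∨ IsListed G (Set.range q) (Set.range p) := by
  have singleton {k j : ℕ} {p : pathGraph k ↪g G} {q : pathGraph j ↪g G} {a : Fin k} {b : Fin j}
      (h : IsPathPair p q) (htwins : Twins G (p a) (q b)) (hk : k = 1) :
      IsListed G (Set.range p) (Set.range q) ∨ IsListed G (Set.range q) (Set.range p) := by
    subst hk
    obtain rfl : a = 0 := Subsingleton.elim a 0
    obtain ⟨W, hW, hpW⟩ := hforts (p 0)
    obtain hj | hj := Nat.lt_or_ge 2 j
    · exact .inl (.inl (h.formA_of_twins htwins hj))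
    · exact .inr (.inr (.inl (h.formB_of_isFort hj hiso hW hpW)))
  obtain hk | hk := eq_or_ne k 1
  · exact singleton h htwins hk
  obtain hj | hj := eq_or_ne j 1
  · exact (singleton h.symm htwins.symm hj).symm
  obtain ⟨m, rfl⟩ := Nat.exists_eq_add_of_le' (show 2 ≤ k by have := a.isLt; omega)
  obtain ⟨l, rfl⟩ := Nat.exists_eq_add_of_le' (show 2 ≤ j by have := b.isLt; omega)
  obtain ⟨ha | hb, hends⟩ := h.ends_of_twins htwins
  · have hb : b.val = l + 1 := by omega
    obtain rfl : a = 0 := Fin.ext ha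
    obtain rfl : b = Fin.last (l + 1) := Fin.ext hb
    exact .inr (.inr (.inr (.inr (h.symm.formD_of_twins htwins.symm))))
  · have ha : a.val = m + 1 := by omega
    obtain rfl : b = 0 := Fin.ext hb
    obtain rfl : a = Fin.last (m + 1) := Fin.ext ha
    exact .inl (.inr (.inr (.inr (h.formD_of_twins htwins))))

theorem isListed_of_twins (h : IsPathPair p q) {u v : V} (htwins : Twins G u v)
    (hiso : ∀ v, ¬G.IsIsolated v) (hforts : ∀ v, ∃ W, IsFort G W ∧ v ∉ W) :
    IsListed G (Set.range p) (Set.range q) ∨ IsListed G (Set.range q) (Set.range p) := by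
  obtain ⟨a, rfl⟩ | ⟨a, rfl⟩ := h.mem_range_or_mem_range u <;>
    obtain ⟨b, rfl⟩ | ⟨b, rfl⟩ := h.mem_range_or_mem_range v
  · exact .inl (h.isListed_of_twins_on_path htwins hiso)
  · exact h.isListed_of_twins_across htwins hiso hforts
  · exact h.isListed_of_twins_across htwins.symm hiso hforts
  · exact .inr (h.symm.isListed_of_twins_on_path htwins hiso)

end IsPathPair

section Paths

variable {V : Type*} {G : SimpleGraph V} {k j : ℕ} {q : pathGraph j ↪g G}

lemma not_isIsolated_path_of_two_le (hk : 2 ≤ k) (p : pathGraph k ↪g G) (i : Fin k) :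
    ¬G.IsIsolated (p i) := by
  obtain ⟨a, ha⟩ : ∃ a, (pathGraph k).Adj i a := by
    rcases neighborSet_pathGraph_eq_pair_or_singleton hk i with ⟨a, b, -, h⟩ | ⟨a, h⟩
    exacts [⟨a, h.superset (.inl rfl)⟩, ⟨a, h.superset rfl⟩]
  exact (p.map_adj_iff.mpr ha).not_isIsolated_left

lemma not_isIsolated_path_of_forall_eq_singleton (h : ∀ x, Set.range q = {x} → ∃ y, G.Adj x y)
    (l : Fin j) : ¬G.IsIsolated (q l) := by
  obtain hj | hj := Nat.lt_or_ge 1 j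
  · exact not_isIsolated_path_of_two_le hj q l
  · have : Subsingleton (Fin j) := Fin.subsingleton_iff_le_one.mpr hj
    have hrange : Set.range q = {q l} :=
      (Set.subsingleton_range q).eq_singleton_of_mem ⟨l, rfl⟩
    exact exists_adj_iff_not_isIsolated.mp (h _ hrange)

lemma neighborSet_inter_range_eq_pair {a b c : Fin j} (hac : a ≠ c) (hab : G.Adj (q a) (q b))
    (hbc : G.Adj (q b) (q c)) : G.neighborSet (q b) ∩ Set.range q = {q a, q c} := by
  rw [neighborSet_inter_range, ← Set.image_pair]
  congr 1
  ext l
  rw [adj_path_iff] at hab hbc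
  simp only [mem_neighborSet, pathGraph_adj, Set.mem_insert_iff, Set.mem_singleton_iff]
  omega

lemma twins_last_zero {m l : ℕ} {p : pathGraph (m + 2) ↪g G} {q : pathGraph (l + 2) ↪g G}
    (hcompl : IsCompl (Set.range p) (Set.range q))
    (hp : ∀ i ≠ Fin.last (m + 1), G.Adj (p i) (q 0) ↔ i = (Fin.last m).castSucc)
    (hq : ∀ x ≠ 0, G.Adj (p (Fin.last (m + 1))) (q x) ↔ x = 1) :
    Twins G (p (Fin.last (m + 1))) (q 0) := by
  refine ⟨hcompl.disjoint.ne_of_mem ⟨_, rfl⟩ ⟨_, rfl⟩, fun y hyp hyq => ?_⟩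
  obtain ⟨i, rfl⟩ | ⟨x, rfl⟩ : y ∈ Set.range p ∨ y ∈ Set.range q :=
    hcompl.sup_eq_top.ge (Set.mem_univ y)
  · rw [G.adj_comm (q 0), hp i (ne_of_apply_ne p hyp), adj_path_iff, Fin.ext_iff]
    simp only [Fin.val_last, Fin.val_castSucc]
    omega
  · rw [hq x (ne_of_apply_ne q hyq), adj_path_iff, Fin.ext_iff]
    simp only [Fin.val_zero, Fin.val_one]
    omega

end Paths

namespace IsPathPair

variable {V : Type*} {G : SimpleGraph V} {k j : ℕ} {p : pathGraph k ↪g G} {q : pathGraph j ↪g G}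

lemma not_isIsolated (h : IsPathPair p q) (hp : ∀ i, ¬G.IsIsolated (p i))
    (hq : ∀ l, ¬G.IsIsolated (q l)) (v : V) : ¬G.IsIsolated v := by
  obtain ⟨i, rfl⟩ | ⟨l, rfl⟩ := h.mem_range_or_mem_range v
  exacts [hp i, hq l]

lemma twins_of_range_eq_singleton (h : IsPathPair p q) {x : V} (hp : Set.range p = {x}) {b : Fin j}
    (hN : G.neighborSet x = G.neighborSet (q b) ∩ Set.range q ∨
      G.neighborSet x = insert (q b) (G.neighborSet (q b) ∩ Set.range q)) : Twins G x (q b) := by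
  have hx : x ∉ Set.range q := h.isCompl.disjoint.notMem_of_mem_left (hp.superset rfl)
  refine ⟨fun hxb => hx ⟨b, hxb.symm⟩, fun y hyx hyb => ?_⟩
  have hy : y ∈ Set.range q := (h.mem_range_or_mem_range y).resolve_left fun hyp =>
    hyx (hp.subset hyp)
  simp only [← mem_neighborSet]
  rcases hN with hN | hN <;>
    simp only [hN, Set.mem_insert_iff, Set.mem_inter_iff, hy, hyb, and_true, false_or]

lemma fortNumber_eq_two_of_formA (h : IsPathPair p q)
    (hform : FormA G (Set.range p) (Set.range q)) : fortNumber G = 2 := by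
  obtain ⟨x, hp, hcard, hN⟩ := hform
  have hj : 2 ≤ j := by
    rw [← Set.image_univ, Set.ncard_image_of_injective _ q.injective, Set.ncard_univ,
      Nat.card_fin] at hcard
    omega
  obtain ⟨b, hb⟩ : ∃ b, G.neighborSet x = G.neighborSet (q b) ∩ Set.range q ∨
      G.neighborSet x = insert (q b) (G.neighborSet (q b) ∩ Set.range q) := by
    rcases hN with ⟨_, ⟨a, rfl⟩, _, ⟨b, rfl⟩, _, ⟨c, rfl⟩, hac, hab, hbc, hN⟩ |
      ⟨_, ⟨b, rfl⟩, w, -, hb, hN⟩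
    · refine ⟨b, ?_⟩
      rwa [neighborSet_inter_range_eq_pair (ne_of_apply_ne q hac) hab hbc, Set.insert_comm]
    · exact ⟨b, by rwa [hb]⟩
  refine fortNumber_eq_two_iff.mpr ⟨⟨x, q b, h.twins_of_range_eq_singleton hp hb⟩,
    h.not_isIsolated (fun i => ?_) (not_isIsolated_path_of_two_le hj q)⟩
  rw [show p i = x from hp.subset ⟨i, rfl⟩, ← neighborSet_nonempty]
  rcases hN with ⟨_, -, _, -, _, -, -, -, -, hN | hN⟩ | ⟨_, -, _, -, -, hN | hN⟩ <;> rw [hN]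
  exacts [Set.insert_nonempty .., Set.insert_nonempty .., Set.singleton_nonempty _,
    Set.insert_nonempty ..]

lemma fortNumber_eq_two_of_formB (h : IsPathPair p q)
    (hform : FormB G (Set.range p) (Set.range q)) : fortNumber G = 2 := by
  obtain ⟨u, v, hp, huv, hN, hx⟩ := hform
  refine fortNumber_eq_two_iff.mpr ⟨⟨u, v, huv.ne, fun x hxu hxv => ?_⟩,
    h.not_isIsolated (fun i => ?_)
      (not_isIsolated_path_of_forall_eq_singleton fun x hq => ⟨u, (hx x hq).1.symm⟩)⟩
  · have hxp : x ∉ Set.range p := by simp [hp, hxu, hxv]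
    have hxq := (h.mem_range_or_mem_range x).resolve_left hxp
    exact (and_congr_left_iff.mp (Set.ext_iff.mp hN x)) hxq
  · obtain hi | hi := hp.subset ⟨i, rfl⟩
    exacts [hi ▸ huv.not_isIsolated_left, hi ▸ huv.not_isIsolated_right]

lemma fortNumber_eq_two_of_formC (h : IsPathPair p q)
    (hform : FormC G (Set.range p) (Set.range q)) : fortNumber G = 2 := by
  obtain ⟨u, v, w, hp, huw, huv, hvw, hN, hx⟩ := hform
  have hN' : G.neighborSet u = G.neighborSet w := by
    rcases hN with ⟨hu, hw⟩ | ⟨x, -, hu, hw⟩ <;> rw [hu, hw]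
  refine fortNumber_eq_two_iff.mpr ⟨⟨u, w, huw, fun x _ _ => Set.ext_iff.mp hN' x⟩,
    h.not_isIsolated (fun i => ?_) (not_isIsolated_path_of_forall_eq_singleton hx)⟩
  obtain hi | hi | hi := hp.subset ⟨i, rfl⟩
  exacts [hi ▸ huv.not_isIsolated_left, hi ▸ hvw.not_isIsolated_left,
    hi ▸ hvw.not_isIsolated_right]

lemma fortNumber_eq_two_of_formD (h : IsPathPair p q)
    (hform : FormD G (Set.range p) (Set.range q)) : fortNumber G = 2 := by
  obtain ⟨m, l, p', q', hp, hq, v', v, w₁, w₂, hv', hv, hw₁, hw₂, hE⟩ := hform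
  obtain rfl : v' = p' (Fin.last m).castSucc := hv'
  obtain rfl : v = p' (Fin.last (m + 1)) := hv
  obtain rfl : w₁ = q' 0 := hw₁
  obtain rfl : w₂ = q' 1 := hw₂
  have hmem (i : Fin (m + 2)) (x : Fin (l + 2)) : G.Adj (p' i) (q' x) ↔
      (p' i, q' x) ∈ edgesBetween G (Set.range p) (Set.range q) :=
    ⟨fun hadj => ⟨hp.subset ⟨i, rfl⟩, hq.subset ⟨x, rfl⟩, hadj⟩, fun hadj => hadj.2.2⟩
  have hcompl : IsCompl (Set.range p') (Set.range q') := by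
    rw [hp, hq]
    exact h.isCompl
  refine fortNumber_eq_two_iff.mpr ⟨⟨_, _, twins_last_zero hcompl (fun i hi => ?_) fun x hx => ?_⟩,
    fun y => ?_⟩
  · rw [hmem]
    rcases hE with hE | hE | hE <;> simp [hE, p'.injective.eq_iff, q'.injective.eq_iff, hi]
  · rw [hmem]
    rcases hE with hE | hE | hE <;>
      simp [hE, p'.injective.eq_iff, q'.injective.eq_iff, hx, (Fin.castSucc_lt_last _).ne']
  · obtain ⟨i, rfl⟩ | ⟨x, rfl⟩ : y ∈ Set.range p' ∨ y ∈ Set.range q' :=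
      hcompl.sup_eq_top.ge (Set.mem_univ y)
    exacts [not_isIsolated_path_of_two_le (by omega) p' i,
      not_isIsolated_path_of_two_le (by omega) q' x]

theorem fortNumber_eq_two_of_isListed (h : IsPathPair p q)
    (hlisted : IsListed G (Set.range p) (Set.range q)) :
    fortNumber G = 2 := by
  obtain hA | hB | hC | hD := hlisted
  exacts [h.fortNumber_eq_two_of_formA hA, h.fortNumber_eq_two_of_formB hB,
    h.fortNumber_eq_two_of_formC hC, h.fortNumber_eq_two_of_formD hD]

end IsPathPair

theorem fortNumber_eq_two_and_zeroForcingNumber_eq_two_iff {V : Type*} {G : SimpleGraph V}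
    [Fintype V] [DecidableEq V] : fortNumber G = 2 ∧ zeroForcingNumber G = 2 ↔
      TwoParallelPaths G ∧ ∀ D : StandardDrawing G, D.HasListedForm := by
  rw [and_comm, twoParallelPaths_iff]
  refine and_congr_right fun hZ => ⟨fun hF D => ?_, fun hlisted => ?_⟩
  · obtain ⟨⟨u, v, htwins⟩, hiso⟩ := fortNumber_eq_two_iff.mp hF
    exact D.isPathPair.isListed_of_twins htwins hiso (exists_isFort_notMem (by omega))
  · obtain ⟨-, ⟨D⟩⟩ := twoParallelPaths_iff.mpr hZ
    obtain hD | hD := hlisted D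
    exacts [D.isPathPair.fortNumber_eq_two_of_isListed hD,
      D.isPathPair.symm.fortNumber_eq_two_of_isListed hD]

end ZeroForcingSpan

theorem mainTheorem1 {V : Type*} [Fintype V] [DecidableEq V] (G : SimpleGraph V) :
    (ZeroForcingSpan.span G : ℤ) = (Fintype.card V : ℤ) - 3 ↔
      (∃ v : V, (∀ w, ¬ G.Adj v w) ∧ ZeroForcingSpan.TwoParallelPaths (G.induce {v}ᶜ)) ∨
      (ZeroForcingSpan.IsPathOn G 4 ∨ ZeroForcingSpan.IsPathOn G 5) ∨
      (ZeroForcingSpan.TwoParallelPaths G ∧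
        ∀ D : ZeroForcingSpan.StandardDrawing G, D.HasListedForm) := by
  open ZeroForcingSpan in
  rw [span_eq_card_sub_three_iff, fortNumber_eq_one_and_zeroForcingNumber_eq_three_iff,
    fortNumber_eq_three_and_zeroForcingNumber_eq_one_iff,
    fortNumber_eq_two_and_zeroForcingNumber_eq_two_iff]
  exact Iff.rfl
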